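/- Let $s\ge 2$ be an integer. Let $\mathbb Z_s$ be the space of $s$-adic integers (sequences of digits in $\{0,\dots,s-1\}$ with the product topology, containing $\mathbb Z_{\ge 0}$ through base-$s$ expansions), and let $H=\ell^2(\mathcal V)$, $\mathcal V=\{(n,x): n\ge 0,\ 0\le x<s^n\}$, with canonical basis $E_{(n,x)}$. For $f\in C(\mathbb Z_s)$ let $M_fE_{(n,x)}=f(x)E_{(n,x)}$, and let $S$ be the Bernoulli shift, the isometry $$SE_{(n,x)}=\frac1{\sqrt s}\sum_{j=0}^{s-1}E_{(n+1,\,sx+j)} .$$ Let $A_S=C^*(S,\,M_f: f\in C(\mathbb Z_s))\subseteq B(H)$. For $0\le j<s$ put $S_j=\sqrt s\,M_{\chi_j}S$, where $\chi_j$ is the characteristic function of $\{x: x \bmod s=j\}$ (so $S_jE_{(n,x)}=E_{(n+1,sx+j)}$). For $(n,x)\in\mathcal V$ with $x=x_0+x_1s+\dots+x_{n-1}s^{n-1}$, $0\le x_k<s$, put $S_{(n,x)}=S_{x_0}S_{x_1}\cdots S_{x_{n-1}}$ (with $S_{(0,0)}=I$), and let $$B_S=C^*\bigl(S_{(n,x)}S_{(n,y)}^*: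 n\ge 0,\ 0\le x,y<s^n\bigr)\subseteq A_S .$$ For $\theta\in\mathbb R$ let $\rho_\theta(a)=\mathcal U_\theta a\,\mathcal U_\theta^{-1}$ be the gauge action, where $\mathcal U_\theta E_{(n,x)}=e^{2\pi i n\theta}E_{(n,x)}$. Theorem. 1. $A_S=C^*(S_0,\dots,S_{s-1})$, and $A_S$ with the generators $S_j$ is the Cuntz–Toeplitz algebra, that is, the universal unital C*-algebra generated by $s$ elements $t_j$ with $t_j^*t_k=\delta_{jk}1$. 2. $B_S$ is the gauge-invariant subalgebra of $A_S$: $B_S=\{a\in A_S:\rho_\theta(a)=a\text{ for all }\theta\}$. 3. $\alpha_S(b)=SbS^*$ defines an injective $*$-endomorphism of $B_S$, with range $\alpha_S(I)B_S\alpha_S(I)$ (so the range is hereditary), and $$A_S\cong B_S\rtimes_{\alpha_S}\mathbb N .$$ Here $B_S\rtimes_{\alpha_S}\mathbb N$ is the universal unital C*-algebra generated by (a unital image of) $B_S$ and an isometry $J$ subject to $\alpha_S(b)=JbJ^*$ for $b\in B_S$; the isomorphism is the identity on $B_S$ and sends $S$ to $J$. -/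

import Mathlib

universe u v w

noncomputable section

namespace BernoulliShift

/-! ### Universal C*-algebras -/

/-- The unital C*-subalgebra of `A` generated by a set `X`. -/
def cstarGen {A : Type u} [CStarAlgebra A] (X : Set A) : StarSubalgebra ℂ A :=
  (StarAlgebra.adjoin ℂ X).topologicalClosure

instance {A : Type u} [CStarAlgebra A] (X : Set A) : IsClosed (cstarGen X : Set A) :=
  StarSubalgebra.isClosed_topologicalClosure _

theorem subset_cstarGen {A : Type u} [CStarAlgebra A] (X : Set A) : X ⊆ (cstarGen X : Set A) :=
  fun _ hx => StarSubalgebra.le_topologicalClosure _ (StarAlgebra.subset_adjoin ℂ X hx)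

theorem cstarGen_le {A : Type u} [CStarAlgebra A] {X : Set A} {B : StarSubalgebra ℂ A}
    (hB : IsClosed (B : Set A)) (h : X ⊆ (B : Set A)) : cstarGen X ≤ B :=
  StarSubalgebra.topologicalClosure_minimal (StarAlgebra.adjoin_le h) hB

/-- The covariance relations of a unital C*-algebra `A` with a (not necessarily unital)
endomorphism `α`: a unital `*`-homomorphism `ι : A → C` and an isometry `J` in `C` with
`ι (α a) = J * ι a * J⋆`. -/
structure IsCovariant {A : Type u} {C : Type v} [CStarAlgebra A] [CStarAlgebra C]
    (α : A →⋆ₙₐ[ℂ] A) (ι : A →⋆ₐ[ℂ] C) (J : C) : Prop where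
  isometry : star J * J = 1
  covariant : ∀ a, ι (α a) = J * ι a * star J

/-- `(C, ι, J)` is the crossed product `A ⋊_α ℕ`: the universal unital C*-algebra generated
by (the image under `ι` of) `A` and an isometry `J` subject to `α a = J a J⋆`. -/
structure IsCrossedProduct {A : Type u} {C : Type v} [CStarAlgebra A] [CStarAlgebra C]
    (α : A →⋆ₙₐ[ℂ] A) (ι : A →⋆ₐ[ℂ] C) (J : C) : Prop where
  isCovariant : IsCovariant α ι J
  generates : cstarGen (Set.range ι ∪ {J}) = ⊤
  universal : ∀ (D : Type w) [CStarAlgebra D] (π : A →⋆ₐ[ℂ] D) (V : D), IsCovariant α π V →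
    ∃! φ : C →⋆ₐ[ℂ] D, (∀ a, φ (ι a) = π a) ∧ φ J = V

/-- `(C, t)` is the Cuntz–Toeplitz algebra `𝒯𝒪_s`: the universal unital C*-algebra generated
by `s` isometries `t j` with `(t j)⋆ (t k) = δ_{jk} 1`. -/
structure IsCuntzToeplitz (s : ℕ) {C : Type v} [CStarAlgebra C] (t : Fin s → C) : Prop where
  relations : ∀ j k, star (t j) * t k = if j = k then 1 else 0
  generates : cstarGen (Set.range t) = ⊤
  universal : ∀ (D : Type w) [CStarAlgebra D] (r : Fin s → D),
    (∀ j k, star (r j) * r k = if j = k then 1 else 0) →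
    ∃! φ : C →⋆ₐ[ℂ] D, ∀ j, φ (t j) = r j

/-- Any two crossed products of `A` by `α` are isomorphic, compatibly with the canonical
maps. -/
theorem IsCrossedProduct.exists_equiv {A : Type u} {C C' : Type v}
    [CStarAlgebra A] [CStarAlgebra C] [CStarAlgebra C'] {α : A →⋆ₙₐ[ℂ] A}
    {ι : A →⋆ₐ[ℂ] C} {J : C} {ι' : A →⋆ₐ[ℂ] C'} {J' : C'}
    (h : IsCrossedProduct.{u, v, v} α ι J) (h' : IsCrossedProduct.{u, v, v} α ι' J') :
    ∃ Φ : C ≃⋆ₐ[ℂ] C', (∀ a, Φ (ι a) = ι' a) ∧ Φ J = J' := by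
  obtain ⟨f, ⟨hf, hfJ⟩, -⟩ := h.universal C' ι' J' h'.isCovariant
  obtain ⟨g, ⟨hg, hgJ⟩, -⟩ := h'.universal C ι J h.isCovariant
  have e₁ : g.comp f = StarAlgHom.id ℂ C :=
    (h.universal C ι J h.isCovariant).unique
      ⟨fun a => by simp [hf, hg], by simp [hfJ, hgJ]⟩ ⟨fun a => rfl, rfl⟩
  have e₂ : f.comp g = StarAlgHom.id ℂ C' :=
    (h'.universal C' ι' J' h'.isCovariant).unique
      ⟨fun a => by simp [hf, hg], by simp [hfJ, hgJ]⟩ ⟨fun a => rfl, rfl⟩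
  exact ⟨StarAlgEquiv.ofStarAlgHom f g e₁ e₂, hf, hfJ⟩

/-! ### The `s`-adic integers and the Hilbert space of the `s`-adic tree -/

/-- The space of `s`-adic integers: sequences of digits, with the product topology. -/
abbrev SAdic (s : ℕ) : Type := ℕ → Fin s

/-- The `s`-adic integer given by the base `s` expansion of a natural number. -/
def ofNat (s : ℕ) [NeZero s] (x : ℕ) : SAdic s := fun k => Fin.ofNat s (x / s ^ k)

/-- Vertices `(n, x)`, `0 ≤ x < s ^ n`, of the `s`-adic tree. -/
abbrev Vertex (s : ℕ) : Type := Σ n : ℕ, Fin (s ^ n)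

/-- The Hilbert space `ℓ²` over the vertices. -/
abbrev Hil (s : ℕ) : Type := lp (fun _ : Vertex s => ℂ) 2

/-- Bounded operators on `ℓ²` of the vertices. -/
abbrev Op (s : ℕ) : Type := Hil s →L[ℂ] Hil s

/-- The canonical basis vector `E_{(n,x)}`. -/
def basisVec (s : ℕ) (v : Vertex s) : Hil s := lp.single 2 v 1

/-- The vertex `(n + 1, s x + j)`. -/
def child {s : ℕ} (v : Vertex s) (j : Fin s) : Vertex s :=
  ⟨v.1 + 1, ⟨s * v.2 + j, by
    have h1 := v.2.isLt
    have h2 := j.isLt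
    calc s * (v.2 : ℕ) + j < s * (v.2 : ℕ) + s := by omega
      _ = s * ((v.2 : ℕ) + 1) := by ring
      _ ≤ s * s ^ v.1 := Nat.mul_le_mul_left _ h1
      _ = s ^ (v.1 + 1) := by ring⟩⟩

theorem child_inj {s : ℕ} {v w : Vertex s} {j k : Fin s} :
    child v j = child w k ↔ v = w ∧ j = k := by
  constructor
  · obtain ⟨n, x⟩ := v
    obtain ⟨m, y⟩ := w
    intro h
    have h1 : n = m := by
      have := congrArg Sigma.fst h
      simpa [child] using this
    subst h1
    have h2 : s * (x : ℕ) + j = s * (y : ℕ) + k := by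
      have h3 := congrArg (fun t : Vertex s => ((t.2 : Fin _) : ℕ)) h
      simpa [child] using h3
    have hj : (j : ℕ) = k := by
      have := congrArg (· % s) h2
      simpa [Nat.mul_add_mod, Nat.mod_eq_of_lt] using this
    have hs : 0 < s := j.pos
    have hx : (x : ℕ) = y := by
      rw [hj] at h2
      exact Nat.eq_of_mul_eq_mul_left hs (by omega)
    exact ⟨by rw [Fin.ext hx], Fin.ext hj⟩
  · rintro ⟨rfl, rfl⟩
    rfl

theorem inner_basisVec {s : ℕ} (v w : Vertex s) :
    inner ℂ (basisVec s v) (basisVec s w) = if v = w then (1 : ℂ) else 0 := by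
  unfold basisVec
  rw [lp.inner_single_left, lp.single_apply, Pi.single_apply]
  split_ifs <;> simp_all

/-! ### Diagonal operators and the multiplication operators -/

theorem memℓp_diag {s : ℕ} (F : Vertex s → ℂ) (C : ℝ) (hF : ∀ v, ‖F v‖ ≤ C) (f : Hil s) :
    Memℓp (fun v => F v * f v) 2 := by
  have h : Memℓp (fun v => (C : ℂ) * f v) 2 := (lp.memℓp f).const_smul (C : ℂ)
  refine h.mono' fun v => ?_
  rw [norm_mul, norm_mul]
  refine mul_le_mul_of_nonneg_right ((hF v).trans ?_) (norm_nonneg _)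
  simpa using le_abs_self C

/-- The diagonal operator `E_v ↦ F v • E_v`, for a function `F` bounded by `C`. -/
def diag {s : ℕ} (F : Vertex s → ℂ) (C : ℝ) (hF : ∀ v, ‖F v‖ ≤ C) : Op s :=
  LinearMap.mkContinuous
    (LinearMap.mk
      (AddHom.mk (fun f : Hil s => (⟨fun v => F v * f v, memℓp_diag F C hF f⟩ : Hil s))
        (fun f g => Subtype.ext (funext fun v => mul_add (F v) (f v) (g v))))
      (fun c f => Subtype.ext (funext fun v => mul_left_comm (F v) c (f v))))
    |C| (fun f => by
      have h : ‖(⟨fun v => F v * f v, memℓp_diag F C hF f⟩ : Hil s)‖ ≤ ‖(C : ℂ) • f‖ := by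
        refine lp.norm_mono (by norm_num) fun v => ?_
        change ‖F v * f v‖ ≤ ‖(C : ℂ) * f v‖
        rw [norm_mul, norm_mul]
        refine mul_le_mul_of_nonneg_right ((hF v).trans ?_) (norm_nonneg _)
        simpa using le_abs_self C
      rw [norm_smul] at h
      simpa using h)

theorem diag_apply {s : ℕ} (F : Vertex s → ℂ) (C : ℝ) (hF : ∀ v, ‖F v‖ ≤ C) (f : Hil s)
    (v : Vertex s) : diag F C hF f v = F v * f v := rfl

theorem diag_basisVec {s : ℕ} (F : Vertex s → ℂ) (C : ℝ) (hF : ∀ v, ‖F v‖ ≤ C) (v : Vertex s) :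
    diag F C hF (basisVec s v) = F v • basisVec s v := by
  refine Subtype.ext (funext fun w => ?_)
  change F w * basisVec s v w = F v * basisVec s v w
  by_cases h : w = v
  · rw [h]
  · simp [basisVec, h]

/-- The multiplication operator `M_f E_{(n,x)} = f x • E_{(n,x)}`, for `f ∈ C(ℤ_s)`. -/
def mulOp (s : ℕ) [NeZero s] (f : C(SAdic s, ℂ)) : Op s :=
  diag (fun v => f (ofNat s v.2)) ‖f‖ (fun _ => f.norm_coe_le_norm _)

/-! ### The Bernoulli shift and its algebras -/

/-- The vector `(1 / √s) ∑_j E_{(n+1, s x + j)}`. -/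
def shiftVec (s : ℕ) (v : Vertex s) : Hil s :=
  ((1 / Real.sqrt s : ℝ) : ℂ) • ∑ j : Fin s, basisVec s (child v j)

theorem orthonormal_shiftVec (s : ℕ) [NeZero s] : Orthonormal ℂ (shiftVec s) := by
  rw [orthonormal_iff_ite]
  intro v w
  have hs : (0 : ℝ) < s := by exact_mod_cast Nat.pos_of_ne_zero (NeZero.ne s)
  have hc : (1 / Real.sqrt s : ℝ) * (1 / Real.sqrt s) * s = 1 := by
    have := Real.mul_self_sqrt hs.le
    have h0 : Real.sqrt s ≠ 0 := (Real.sqrt_pos.2 hs).ne'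
    field_simp
    nlinarith
  have hc' : ((1 / Real.sqrt s : ℝ) : ℂ) * (((1 / Real.sqrt s : ℝ) : ℂ) * s) = 1 := by
    rw [← mul_assoc]; exact_mod_cast hc
  simp only [shiftVec, inner_smul_left, inner_smul_right, sum_inner, inner_sum, inner_basisVec,
    child_inj, Complex.conj_ofReal]
  by_cases h : v = w
  · simpa [h, mul_comm (s : ℂ)] using hc'
  · simp [h]

/-- The Bernoulli shift `S E_{(n,x)} = (1 / √s) ∑_j E_{(n+1, s x + j)}`. -/
def shift (s : ℕ) [NeZero s] : Op s :=
  (orthonormal_shiftVec s).orthogonalFamily.linearIsometry.toContinuousLinearMap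

theorem shift_basisVec (s : ℕ) [NeZero s] (v : Vertex s) :
    shift s (basisVec s v) = shiftVec s v := by
  refine ((orthonormal_shiftVec s).orthogonalFamily.linearIsometry_apply_single (1 : ℂ)).trans ?_
  simp [LinearIsometry.toSpanSingleton_apply]

/-- The Bernoulli shift algebra `A_S`, generated by `S` and the `M_f`, `f ∈ C(ℤ_s)`. -/
def shiftAlgebra (s : ℕ) [NeZero s] : StarSubalgebra ℂ (Op s) :=
  cstarGen ({shift s} ∪ Set.range (mulOp s))

/-- The characteristic function of the ball `{x : x mod s = j}`. -/
def charBall (s : ℕ) (j : Fin s) : C(SAdic s, ℂ) where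
  toFun x := if x 0 = j then 1 else 0
  continuous_toFun :=
    (continuous_of_discreteTopology (f := fun d : Fin s => if d = j then (1 : ℂ) else 0)).comp
      (continuous_apply 0)

/-- The operators `S_j = √s M_{χ_j} S`, so that `S_j E_{(n,x)} = E_{(n+1, s x + j)}`. -/
def genS (s : ℕ) [NeZero s] (j : Fin s) : Op s :=
  ((Real.sqrt s : ℝ) : ℂ) • (mulOp s (charBall s j) * shift s)

/-- The operators `S_{(n,x)} = S_{x_0} S_{x_1} ⋯ S_{x_{n-1}}`, where
`x = x_0 + x_1 s + ⋯ + x_{n-1} s ^ (n-1)`. -/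
def wordS (s : ℕ) [NeZero s] (v : Vertex s) : Op s :=
  (List.ofFn fun k : Fin v.1 => genS s (ofNat s v.2 k)).prod

/-- The algebra `B_S`, generated by the `S_{(n,x)} S_{(n,y)}⋆`. -/
def coeffAlgebra (s : ℕ) [NeZero s] : StarSubalgebra ℂ (Op s) :=
  cstarGen {a | ∃ (n : ℕ) (x y : Fin (s ^ n)), a = wordS s ⟨n, x⟩ * star (wordS s ⟨n, y⟩)}

instance (s : ℕ) [NeZero s] : IsClosed (shiftAlgebra s : Set (Op s)) :=
  StarSubalgebra.isClosed_topologicalClosure _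

instance (s : ℕ) [NeZero s] : IsClosed (coeffAlgebra s : Set (Op s)) :=
  StarSubalgebra.isClosed_topologicalClosure _

theorem shift_mem (s : ℕ) [NeZero s] : shift s ∈ shiftAlgebra s :=
  subset_cstarGen _ (Or.inl rfl)

theorem genS_mem (s : ℕ) [NeZero s] (j : Fin s) : genS s j ∈ shiftAlgebra s :=
  SMulMemClass.smul_mem _ (mul_mem (subset_cstarGen _ (Or.inr ⟨_, rfl⟩)) (shift_mem s))

theorem wordS_mem (s : ℕ) [NeZero s] (v : Vertex s) : wordS s v ∈ shiftAlgebra s := by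
  refine list_prod_mem fun a ha => ?_
  obtain ⟨k, rfl⟩ := List.mem_ofFn.1 ha
  exact genS_mem s _

theorem coeffAlgebra_le (s : ℕ) [NeZero s] : coeffAlgebra s ≤ shiftAlgebra s := by
  refine cstarGen_le inferInstance ?_
  rintro _ ⟨n, x, y, rfl⟩
  exact mul_mem (wordS_mem s _) (star_mem (wordS_mem s _))

/-- The unitary `U_θ E_{(n,x)} = e^{2π i n θ} E_{(n,x)}`; it satisfies `U_θ⁻¹ = U_{-θ}`. -/
def gaugeU (s : ℕ) (θ : ℝ) : Op s :=
  diag (fun v => Complex.exp (((2 * Real.pi * v.1 * θ : ℝ) : ℂ) * Complex.I)) 1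
    (fun _ => (Complex.norm_exp_ofReal_mul_I _).le)

/-- The gauge action `ρ_θ a = U_θ a U_θ⁻¹`. -/
def gauge (s : ℕ) (θ : ℝ) (a : Op s) : Op s := gaugeU s θ * a * gaugeU s (-θ)

end BernoulliShift

end

noncomputable section

namespace BernoulliShift

/-! ### Compressions of operators with coefficients in a C*-algebra -/

section Compression

open scoped ComplexOrder

variable {ι : Type*} [Fintype ι] {D : Type*} [CStarAlgebra D]

/-! Indexing vertices by words of digits, lowest digit first, turns the tree into the free monoid on
`s` letters, and `S_j` prepends `j`. So the `S_j` are the creation operators on full Fock space.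

Since `S = s^{-1/2} ∑ S_j`, the algebra `A_S` is generated by the `S_j` once each `M_f` lies in
their algebra. This follows by stripping first digits (`mulOp_eq`) and Stone–Weierstrass.

Universality means that `‖∑ c r_a r_b⋆‖ ≤ ‖∑ c S_a S_b⋆‖` for every family `r` with the same
relations (`norm_sum_word_le`). It comes from a Poisson kernel: for `t < 1` put `T_u = t^|u| r_u Δ`
with `Δ² = 1 - t² ∑ r_j r_j⋆`. Then `∑ T_u T_u⋆ = 1`, so `A ↦ ∑ ⟨E_w, A E_v⟩ T_w T_v⋆` is
contractive, and it sends `S_a S_b⋆` to `t^(|a|+|b|) r_a r_b⋆`. Let `t → 1`. The pairs `(S_j, r_j)`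
then generate the graph of a homomorphism.

A gauge-invariant element is fixed by averaging over the `n`-th roots of unity, while for large `n`
that average carries a given combination of words into `B_S`; density does the rest.

For the crossed product, `S⋆S_j = s^{-1/2}`, so `S_j = √s (S_j S_0⋆) S`. A covariant pair `(π, V)`
therefore yields candidates `r_j = √s π(S_j S_0⋆) V`. They satisfy the Cuntz–Toeplitz relations, and
the resulting homomorphism extends `π` and sends `S` to `V`. -/

theorem norm_sum_mul_star_sq_le (X Y : ι → D) :
    ‖∑ i, X i * star (Y i)‖ ^ 2 ≤ ‖∑ i, X i * star (X i)‖ * ‖∑ i, Y i * star (Y i)‖ := by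
  let _ := CStarAlgebra.spectralOrder D
  have _ := CStarAlgebra.spectralOrderedRing D
  let x : WithCStarModule D (ι → D) := X
  let y : WithCStarModule D (ι → D) := Y
  -- Cauchy–Schwarz in the Hilbert module `D^ι`; the module inner product is `⟨a, b⟩ = b * star a`,
  -- hence the order `y`, `x`.
  have h := CStarModule.norm_inner_le (A := D) (WithCStarModule D (ι → D)) (x := y) (y := x)
  have hx := WithCStarModule.pi_norm_sq (A := D) (E := fun _ : ι => D) x
  have hy := WithCStarModule.pi_norm_sq (A := D) (E := fun _ : ι => D) y
  rw [WithCStarModule.pi_inner (A := D) (E := fun _ : ι => D)] at h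
  simp only [WithCStarModule.inner_def] at h hx hy
  change ‖∑ i, X i * star (Y i)‖ ≤ ‖y‖ * ‖x‖ at h
  change ‖x‖ ^ 2 = ‖∑ i, X i * star (X i)‖ at hx
  change ‖y‖ ^ 2 = ‖∑ i, Y i * star (Y i)‖ at hy
  rw [← hx, ← hy, ← mul_pow, mul_comm]
  exact pow_le_pow_left₀ (norm_nonneg _) h 2

-- Factoring `P = B⋆B` turns the double sum into `∑ Z_u Z_u⋆` with `Z_u = ∑ conj(B u i) T i`.
open scoped MatrixOrder Matrix.Norms.L2Operator in
theorem sum_smul_mul_star_nonneg [PartialOrder D] [StarOrderedRing D] {P : Matrix ι ι ℂ}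
    (hP : P.PosSemidef) (T : ι → D) : 0 ≤ ∑ i, ∑ j, P i j • (T i * star (T j)) := by
  classical
  obtain ⟨B, rfl⟩ := CStarAlgebra.nonneg_iff_eq_star_mul_self.mp hP.nonneg
  have h : ∑ i, ∑ j, (star B * B) i j • (T i * star (T j)) =
      ∑ u, (∑ i, star (B u i) • T i) * star (∑ i, star (B u i) • T i) := by
    simp only [Matrix.mul_apply, Matrix.star_apply, Finset.sum_smul, star_sum, star_smul, star_star,
      Finset.sum_mul_sum, smul_mul_smul_comm]
    exact ((Finset.sum_comm).trans (Finset.sum_congr rfl fun i _ => Finset.sum_comm)).symm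
  rw [h]
  exact Finset.sum_nonneg fun u _ => mul_star_self_nonneg _

variable {H : Type*} [NormedAddCommGroup H] [InnerProductSpace ℂ H]

/-- A compression does not increase the norm: Bessel's inequality bounds the compressed vector by
`‖A (∑ x j • E j)‖`. -/
theorem posSemidef_norm_sq_sub [DecidableEq ι] {E : ι → H} (hE : Orthonormal ℂ E)
    (A : H →L[ℂ] H) :
    (((‖A‖ ^ 2 : ℝ) : ℂ) • (1 : Matrix ι ι ℂ) -
      (Matrix.of fun i j => inner ℂ (E i) (A (E j))).conjTranspose *
        (Matrix.of fun i j => inner ℂ (E i) (A (E j)))).PosSemidef := by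
  set a : Matrix ι ι ℂ := Matrix.of fun i j => inner ℂ (E i) (A (E j)) with ha
  refine Matrix.PosSemidef.of_dotProduct_mulVec_nonneg ?_ fun x => ?_
  · refine Matrix.IsHermitian.sub ?_ (Matrix.isHermitian_conjTranspose_mul_self a)
    rw [Matrix.IsHermitian, Matrix.conjTranspose_smul]
    simp
  · have hx : ∀ i, (a.mulVec x) i = inner ℂ (E i) (A (∑ j, x j • E j)) := fun i => by
      simp [Matrix.mulVec, dotProduct, ha, mul_comm]
    have h1 : ∑ i, ‖a.mulVec x i‖ ^ 2 ≤ ‖A‖ ^ 2 * ∑ i, ‖x i‖ ^ 2 := by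
      have h2 : ‖∑ j, x j • E j‖ ^ 2 = ∑ i, ‖x i‖ ^ 2 := by
        have := hE.inner_sum x x Finset.univ
        rw [inner_self_eq_norm_sq_to_K] at this
        have h3 : ((‖∑ j, x j • E j‖ ^ 2 : ℝ) : ℂ) = ((∑ i, ‖x i‖ ^ 2 : ℝ) : ℂ) := by
          push_cast
          refine (this.trans ?_)
          exact Finset.sum_congr rfl fun i _ => by rw [RCLike.conj_mul]; rfl
        exact_mod_cast h3
      calc ∑ i, ‖a.mulVec x i‖ ^ 2 ≤ ‖A (∑ j, x j • E j)‖ ^ 2 := by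
            simp only [hx]
            exact hE.sum_inner_products_le _
        _ ≤ (‖A‖ * ‖∑ j, x j • E j‖) ^ 2 :=
            pow_le_pow_left₀ (norm_nonneg _) (A.le_opNorm _) 2
        _ = _ := by rw [mul_pow, h2]
    have key : star x ⬝ᵥ ((((‖A‖ ^ 2 : ℝ) : ℂ) • (1 : Matrix ι ι ℂ) - a.conjTranspose * a).mulVec x)
        = ((‖A‖ ^ 2 * ∑ i, ‖x i‖ ^ 2 - ∑ i, ‖a.mulVec x i‖ ^ 2 : ℝ) : ℂ) := by
      have h4 : ∀ y : ι → ℂ, star y ⬝ᵥ y = ((∑ i, ‖y i‖ ^ 2 : ℝ) : ℂ) := fun y => by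
        push_cast
        exact Finset.sum_congr rfl fun i _ => Complex.conj_mul' _
      rw [Matrix.sub_mulVec, dotProduct_sub, Matrix.smul_mulVec, Matrix.one_mulVec,
        dotProduct_smul, ← Matrix.mulVec_mulVec, Matrix.dotProduct_mulVec,
        Matrix.vecMul_conjTranspose, star_star, h4, h4]
      push_cast
      simp
    rw [key]
    exact_mod_cast sub_nonneg.2 h1

/-- If `∑ T i (T i)⋆` is a contraction, then `A ↦ ∑ ⟨E i, A E j⟩ T i (T j)⋆` is contractive. -/
theorem norm_sum_inner_smul_mul_star_le {E : ι → H} (hE : Orthonormal ℂ E) (A : H →L[ℂ] H)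
    (T : ι → D) (hT : ‖∑ i, T i * star (T i)‖ ≤ 1) :
    ‖∑ i, ∑ j, inner ℂ (E i) (A (E j)) • (T i * star (T j))‖ ≤ ‖A‖ := by
  classical
  let _ := CStarAlgebra.spectralOrder D
  have _ := CStarAlgebra.spectralOrderedRing D
  set a : Matrix ι ι ℂ := Matrix.of fun i j => inner ℂ (E i) (A (E j)) with ha
  -- With this `Y` the double sum is `∑ T i (Y i)⋆`, ready for Cauchy–Schwarz. Moreover `∑ Y i (Y
  -- i)⋆` has coefficient matrix `a⋆a ≤ ‖A‖²`.
  let Y : ι → D := fun i => ∑ j, star (a i j) • T j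
  have h1 : ∑ i, ∑ j, inner ℂ (E i) (A (E j)) • (T i * star (T j)) = ∑ i, T i * star (Y i) := by
    simp [Y, star_sum, star_smul, Finset.mul_sum, ha]
  have h2 : ∑ i, Y i * star (Y i) =
      ∑ i, ∑ j, (a.conjTranspose * a) i j • (T i * star (T j)) := by
    simp only [Matrix.mul_apply, Matrix.conjTranspose_apply, Finset.sum_smul, star_sum, star_smul,
      star_star, Finset.sum_mul_sum, smul_mul_smul_comm, Y]
    exact (Finset.sum_comm).trans (Finset.sum_congr rfl fun i _ => Finset.sum_comm)
  have h3 : ∑ i, Y i * star (Y i) ≤ ((‖A‖ ^ 2 : ℝ) : ℂ) • ∑ i, T i * star (T i) := by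
    have := sum_smul_mul_star_nonneg (posSemidef_norm_sq_sub hE A) T
    rw [← ha] at this
    rw [← sub_nonneg, h2, Finset.smul_sum, ← Finset.sum_sub_distrib]
    refine this.trans_eq (Finset.sum_congr rfl fun i _ => ?_)
    simp [sub_smul, Finset.sum_sub_distrib, Matrix.one_apply]
  have h4 : ‖∑ i, Y i * star (Y i)‖ ≤ ‖A‖ ^ 2 := by
    refine (CStarAlgebra.norm_le_norm_of_nonneg_of_le
      (Finset.sum_nonneg fun u _ => mul_star_self_nonneg _) h3).trans ?_
    rw [norm_smul]
    simpa using mul_le_of_le_one_right (sq_nonneg ‖A‖) hT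
  rw [h1]
  refine le_of_sq_le_sq ?_ (norm_nonneg _)
  calc _ ≤ _ := norm_sum_mul_star_sq_le T Y
    _ ≤ 1 * ‖A‖ ^ 2 := mul_le_mul hT h4 (norm_nonneg _) zero_le_one
    _ = _ := one_mul _

end Compression

/-! ### Words in isometries with orthogonal ranges -/

section Words

variable {s : ℕ} {D : Type*} [CStarAlgebra D]

/-- The product `t a_0 * t a_1 * ⋯` along a word. -/
def word (t : Fin s → D) (a : List (Fin s)) : D := (a.map t).prod

@[simp] theorem word_nil (t : Fin s → D) : word t [] = 1 := rfl

@[simp] theorem word_cons (t : Fin s → D) (j : Fin s) (a : List (Fin s)) :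
    word t (j :: a) = t j * word t a := by simp [word]

theorem word_append (t : Fin s → D) (a b : List (Fin s)) :
    word t (a ++ b) = word t a * word t b := by simp [word]

/-- The relations `(t j)⋆ (t k) = δ_{jk} 1`. -/
def OrthIsometries (t : Fin s → D) : Prop :=
  ∀ j k, star (t j) * t k = if j = k then 1 else 0

/-- The linear span of the elements `t_a (t_b)⋆`. -/
def wordSpan (t : Fin s → D) : Submodule ℂ D :=
  Submodule.span ℂ (Set.range fun p : List (Fin s) × List (Fin s) => word t p.1 * star (word t p.2))

theorem word_mul_star_mem (t : Fin s → D) (a b : List (Fin s)) :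
    word t a * star (word t b) ∈ wordSpan t :=
  Submodule.subset_span ⟨(a, b), rfl⟩

/-- Equal first letters cancel and distinct ones annihilate, so the product is nonzero only if one
word is a prefix of the other, and then a suffix is left. -/
theorem OrthIsometries.star_word_mul_word {t : Fin s → D} (ht : OrthIsometries t) :
    ∀ b c : List (Fin s), (∃ d, star (word t b) * word t c = word t d) ∨
      (∃ d, star (word t b) * word t c = star (word t d)) ∨ star (word t b) * word t c = 0
  | [], c => Or.inl ⟨c, by simp⟩
  | b, [] => Or.inr (Or.inl ⟨b, by simp⟩)
  | j :: b, k :: c => by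
    have h : star (word t (j :: b)) * word t (k :: c) =
        star (word t b) * (star (t j) * t k) * word t c := by
      simp [mul_assoc]
    rw [h, ht j k]
    by_cases hjk : j = k
    · simpa [hjk] using ht.star_word_mul_word b c
    · simp [hjk]

theorem OrthIsometries.mul_mem_wordSpan {t : Fin s → D} (ht : OrthIsometries t) {x y : D}
    (hx : x ∈ wordSpan t) (hy : y ∈ wordSpan t) : x * y ∈ wordSpan t := by
  induction hx, hy using Submodule.span_induction₂ with
  | mem_mem x y hx hy =>
    obtain ⟨⟨a, b⟩, rfl⟩ := hx
    obtain ⟨⟨c, d⟩, rfl⟩ := hy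
    have h : word t a * star (word t b) * (word t c * star (word t d)) =
        word t a * (star (word t b) * word t c) * star (word t d) := by simp only [mul_assoc]
    simp only [h]
    rcases ht.star_word_mul_word b c with ⟨e, he⟩ | ⟨e, he⟩ | he
    · rw [he, ← word_append]; exact word_mul_star_mem _ _ _
    · rw [he, mul_assoc, ← star_mul, ← word_append]; exact word_mul_star_mem _ _ _
    · simp [he]
  | zero_left y hy => simp
  | zero_right x hx => simp
  | add_left x y z _ _ _ h1 h2 => rw [add_mul]; exact add_mem h1 h2
  | add_right x y z _ _ _ h1 h2 => rw [mul_add]; exact add_mem h1 h2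
  | smul_left r x y _ _ h => rw [smul_mul_assoc]; exact Submodule.smul_mem _ _ h
  | smul_right r x y _ _ h => rw [mul_smul_comm]; exact Submodule.smul_mem _ _ h

theorem star_mem_wordSpan {t : Fin s → D} {x : D} (hx : x ∈ wordSpan t) :
    star x ∈ wordSpan t := by
  induction hx using Submodule.span_induction with
  | mem x hx =>
    obtain ⟨⟨a, b⟩, rfl⟩ := hx
    simpa using word_mul_star_mem t b a
  | zero => simp
  | add x y _ _ h1 h2 => rw [star_add]; exact add_mem h1 h2
  | smul r x _ h => rw [star_smul]; exact Submodule.smul_mem _ _ h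

theorem OrthIsometries.adjoin_le_wordSpan {t : Fin s → D} (ht : OrthIsometries t) {x : D}
    (hx : x ∈ StarAlgebra.adjoin ℂ (Set.range t)) : x ∈ wordSpan t := by
  induction hx using StarAlgebra.adjoin_induction with
  | mem x hx =>
    obtain ⟨j, rfl⟩ := hx
    simpa using word_mul_star_mem t [j] []
  | algebraMap r =>
    rw [Algebra.algebraMap_eq_smul_one]
    exact Submodule.smul_mem _ _ (by simpa using word_mul_star_mem t [] [])
  | add x y _ _ h1 h2 => exact add_mem h1 h2
  | mul x y _ _ h1 h2 => exact ht.mul_mem_wordSpan h1 h2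
  | star x _ h => exact star_mem_wordSpan h

theorem OrthIsometries.mem_closure_wordSpan {t : Fin s → D} (ht : OrthIsometries t) {x : D}
    (hx : x ∈ cstarGen (Set.range t)) : x ∈ closure (wordSpan t : Set D) :=
  closure_mono (fun _ h => ht.adjoin_le_wordSpan h) hx

end Words

/-! ### The operators `S_j` and the canonical basis -/

section Basis

variable {s : ℕ}

theorem op_mul_apply (A B : Op s) (x : Hil s) : (A * B) x = A (B x) := rfl

theorem continuous_starAlgHom {A B : Type*} [CStarAlgebra A] [CStarAlgebra B] (φ : A →⋆ₐ[ℂ] B) :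
    Continuous φ :=
  AddMonoidHomClass.continuous_of_bound φ 1 fun a => by
    simpa using NonUnitalStarAlgHom.norm_apply_le φ a

theorem orthonormal_basisVec (s : ℕ) : Orthonormal ℂ (basisVec s) :=
  orthonormal_iff_ite.2 inner_basisVec

theorem op_ext {A B : Op s} (h : ∀ v, A (basisVec s v) = B (basisVec s v)) : A = B := by
  refine lp.ext_continuousLinearMap (by norm_num) fun v => ?_
  ext
  simpa [basisVec] using congrArg (fun f : Hil s => f _) (h v)

theorem eq_of_inner_basisVec {x y : Hil s}
    (h : ∀ v, inner ℂ (basisVec s v) x = inner ℂ (basisVec s v) y) : x = y := by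
  refine Subtype.ext (funext fun v => ?_)
  simpa [basisVec, lp.inner_single_left] using h v

/-- The `s`-adic integer `j + s x`. -/
def consDigit (j : Fin s) (x : SAdic s) : SAdic s := fun k => Nat.casesOn k j x

theorem continuous_consDigit (j : Fin s) : Continuous (consDigit j) := by
  refine continuous_pi fun k => ?_
  cases k with
  | zero => exact continuous_const
  | succ k => exact continuous_apply k

theorem ofNat_mul_add [NeZero s] (x : ℕ) (j : Fin s) :
    ofNat s (s * x + j) = consDigit j (ofNat s x) := by
  have hs : 0 < s := Nat.pos_of_ne_zero (NeZero.ne s)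
  funext k
  refine Fin.ext ?_
  cases k with
  | zero => simp [ofNat, consDigit, Nat.mod_eq_of_lt j.isLt]
  | succ k =>
    have : (s * x + j) / s ^ (k + 1) = x / s ^ k := by
      rw [pow_succ', ← Nat.div_div_eq_div_mul, Nat.mul_add_div hs, Nat.div_eq_of_lt j.isLt,
        add_zero]
    simp [ofNat, consDigit, this]

theorem ofNat_zero [NeZero s] : ofNat s 0 = 0 := by
  funext k
  simp [ofNat]

/-- The root `(0, 0)` of the tree. -/
def root (s : ℕ) : Vertex s := ⟨0, ⟨0, by simp⟩⟩

theorem child_ne_root (v : Vertex s) (j : Fin s) : child v j ≠ root s :=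
  fun h => by simpa [child, root] using congrArg Sigma.fst h

theorem eq_root_or_child [NeZero s] (v : Vertex s) : v = root s ∨ ∃ w j, v = child w j := by
  have hs : 0 < s := Nat.pos_of_ne_zero (NeZero.ne s)
  obtain ⟨n, x⟩ := v
  cases n with
  | zero =>
    refine Or.inl ?_
    have := x.isLt
    simp only [root, Sigma.mk.injEq, heq_eq_eq, true_and]
    exact Fin.ext (by simpa using this)
  | succ n =>
    refine Or.inr ⟨⟨n, ⟨x / s, Nat.div_lt_of_lt_mul (by rw [← pow_succ']; exact x.isLt)⟩⟩,
      ⟨x % s, Nat.mod_lt _ hs⟩, ?_⟩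
    simp only [child, Nat.div_add_mod]

variable [NeZero s]

theorem mulOp_basisVec (f : C(SAdic s, ℂ)) (v : Vertex s) :
    mulOp s f (basisVec s v) = f (ofNat s v.2) • basisVec s v :=
  diag_basisVec _ _ _ _

theorem mulOp_basisVec_child (f : C(SAdic s, ℂ)) (v : Vertex s) (j : Fin s) :
    mulOp s f (basisVec s (child v j)) =
      f (consDigit j (ofNat s v.2)) • basisVec s (child v j) := by
  rw [mulOp_basisVec, ← ofNat_mul_add]
  rfl

theorem sqrt_mul_inv_sqrt : ((Real.sqrt s : ℝ) : ℂ) * ((1 / Real.sqrt s : ℝ) : ℂ) = 1 := by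
  have hs : (0 : ℝ) < s := by exact_mod_cast Nat.pos_of_ne_zero (NeZero.ne s)
  have h0 : Real.sqrt s ≠ 0 := (Real.sqrt_pos.2 hs).ne'
  rw [← Complex.ofReal_mul]
  simp [h0]

theorem genS_basisVec (j : Fin s) (v : Vertex s) :
    genS s j (basisVec s v) = basisVec s (child v j) := by
  have h : ∀ k, mulOp s (charBall s j) (basisVec s (child v k)) =
      if k = j then basisVec s (child v k) else 0 := fun k => by
    rw [mulOp_basisVec_child]
    change (if k = j then (1 : ℂ) else 0) • _ = _
    split_ifs <;> simp
  simp only [genS, smul_apply, op_mul_apply,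
    shift_basisVec, shiftVec, map_smul, map_sum, h, smul_smul, sqrt_mul_inv_sqrt]
  simp

theorem orthIsometries_genS : OrthIsometries (genS s) := by
  intro j k
  refine op_ext fun v => eq_of_inner_basisVec fun w => ?_
  rw [op_mul_apply, ContinuousLinearMap.star_eq_adjoint,
    ContinuousLinearMap.adjoint_inner_right, genS_basisVec, genS_basisVec, inner_basisVec]
  by_cases hjk : j = k <;> simp [hjk, inner_basisVec, child_inj]

theorem star_genS_child (j k : Fin s) (v : Vertex s) :
    star (genS s j) (basisVec s (child v k)) = if j = k then basisVec s v else 0 := by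
  rw [← genS_basisVec, ← op_mul_apply, orthIsometries_genS j k]
  split_ifs <;> simp

theorem star_genS_root (j : Fin s) : star (genS s j) (basisVec s (root s)) = 0 := by
  refine eq_of_inner_basisVec fun w => ?_
  rw [ContinuousLinearMap.star_eq_adjoint, ContinuousLinearMap.adjoint_inner_right, genS_basisVec,
    inner_basisVec, if_neg (child_ne_root w j), inner_zero_right]

theorem shift_eq_sum : shift s = ((1 / Real.sqrt s : ℝ) : ℂ) • ∑ j, genS s j := by
  refine op_ext fun v => ?_
  simp [shift_basisVec, shiftVec, genS_basisVec]

/-! ### The multiplication operators lie in the algebra of the `S_j` -/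

/-- On the range of `S_j` the label has first digit `j`, and the remaining digits are those of the
parent. The complement of these ranges is the root, labelled `0`. -/
theorem mulOp_eq (f : C(SAdic s, ℂ)) :
    mulOp s f = ∑ j, genS s j * mulOp s (f.comp ⟨consDigit j, continuous_consDigit j⟩) *
        star (genS s j) + f 0 • (1 - ∑ j, genS s j * star (genS s j)) := by
  refine op_ext fun v => ?_
  simp only [add_apply, sum_apply,
    op_mul_apply, smul_apply, sub_apply,
    one_apply_eq_self]
  rcases eq_root_or_child v with rfl | ⟨w, k, rfl⟩
  · simp only [star_genS_root, map_zero, Finset.sum_const_zero, zero_add, sub_zero,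
      mulOp_basisVec]
    rw [← ofNat_zero]
    rfl
  · simp [star_genS_child, apply_ite, mulOp_basisVec_child,
      mulOp_basisVec _ w, genS_basisVec]

/-- The multiplication operators as a representation of `C(ℤ_s)`. -/
def mulHom (s : ℕ) [NeZero s] : C(SAdic s, ℂ) →⋆ₐ[ℂ] Op s where
  toFun := mulOp s
  map_one' := op_ext fun v => by simp [mulOp_basisVec]
  map_mul' f g := op_ext fun v => by
    simp [mulOp_basisVec, smul_smul, mul_comm]
  map_zero' := op_ext fun v => by simp [mulOp_basisVec]
  map_add' f g := op_ext fun v => by simp [mulOp_basisVec, add_smul]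
  commutes' r := op_ext fun v => by simp [mulOp_basisVec, Algebra.algebraMap_eq_smul_one]
  map_star' f := op_ext fun v => eq_of_inner_basisVec fun w => by
    rw [ContinuousLinearMap.star_eq_adjoint, ContinuousLinearMap.adjoint_inner_right,
      mulOp_basisVec, mulOp_basisVec, inner_smul_left, inner_smul_right, inner_basisVec]
    split_ifs with h
    · rw [h]; rfl
    · simp

theorem mulOp_mem_cstarGen (f : C(SAdic s, ℂ)) : mulOp s f ∈ cstarGen (Set.range (genS s)) := by
  have hg : ∀ j, genS s j ∈ cstarGen (Set.range (genS s)) :=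
    fun j => subset_cstarGen _ ⟨j, rfl⟩
  let K : StarSubalgebra ℂ C(SAdic s, ℂ) := (cstarGen (Set.range (genS s))).comap (mulHom s)
  have hstep : ∀ f : C(SAdic s, ℂ),
      (∀ j, mulOp s (f.comp ⟨consDigit j, continuous_consDigit j⟩) ∈
        cstarGen (Set.range (genS s))) → mulOp s f ∈ cstarGen (Set.range (genS s)) := fun f hf => by
    rw [mulOp_eq f]
    exact add_mem (sum_mem fun j _ => mul_mem (mul_mem (hg j) (hf j)) (star_mem (hg j)))
      (SMulMemClass.smul_mem _ (sub_mem (one_mem _)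
        (sum_mem fun j _ => mul_mem (hg j) (star_mem (hg j)))))
  have hconst : ∀ c : ℂ, mulOp s (algebraMap ℂ C(SAdic s, ℂ) c) ∈ cstarGen (Set.range (genS s)) :=
    fun c => by
      have : mulOp s (algebraMap ℂ C(SAdic s, ℂ) c) = algebraMap ℂ (Op s) c :=
        AlgHomClass.commutes (mulHom s) c
      rw [this]
      exact algebraMap_mem _ c
  -- Prepending a digit turns a function of digit `k + 1` into one of digit `k`, and a function of
  -- digit `0` into a constant.
  have hdigit : ∀ (k : ℕ) (h : Fin s → ℂ),
      mulOp s ⟨fun x => h (x k), continuous_of_discreteTopology.comp (continuous_apply k)⟩ ∈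
        cstarGen (Set.range (genS s)) := fun k => by
    induction k with
    | zero => exact fun h => hstep _ fun j => hconst (h j)
    | succ k ih => exact fun h => hstep _ fun j => ih h
  have hsep : K.SeparatesPoints := fun x y hxy => by
    obtain ⟨k, hk⟩ := Function.ne_iff.1 hxy
    refine ⟨_, ⟨_, hdigit k fun d => if d = x k then 1 else 0, rfl⟩, ?_⟩
    simp [Ne.symm hk]
  have hK : IsClosed (K : Set C(SAdic s, ℂ)) :=
    (StarSubalgebra.isClosed_topologicalClosure _ :
      IsClosed (cstarGen (Set.range (genS s)) : Set (Op s))).preimage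
      (continuous_starAlgHom (mulHom s))
  have htop := ContinuousMap.starSubalgebra_topologicalClosure_eq_top_of_separatesPoints K hsep
  have : f ∈ K.topologicalClosure := by rw [htop]; trivial
  exact StarSubalgebra.topologicalClosure_minimal le_rfl hK this

theorem shift_mem_cstarGen : shift s ∈ cstarGen (Set.range (genS s)) := by
  rw [shift_eq_sum]
  exact SMulMemClass.smul_mem _ (sum_mem fun j _ => subset_cstarGen _ ⟨j, rfl⟩)

theorem shiftAlgebra_eq : shiftAlgebra s = cstarGen (Set.range (genS s)) := by
  refine le_antisymm (cstarGen_le inferInstance ?_) (cstarGen_le inferInstance ?_)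
  · rintro _ (rfl | ⟨f, rfl⟩)
    · exact shift_mem_cstarGen
    · exact mulOp_mem_cstarGen f
  · rintro _ ⟨j, rfl⟩
    exact genS_mem s j

end Basis

/-! ### Words and vertices -/

section Vertices

variable {s : ℕ}

/-- The vertex with a given list of digits. -/
def vtx : List (Fin s) → Vertex s
  | [] => root s
  | j :: a => child (vtx a) j

theorem vtx_fst : ∀ a : List (Fin s), (vtx a).1 = a.length
  | [] => rfl
  | _ :: a => congrArg (· + 1) (vtx_fst a)

theorem vtx_injective : Function.Injective (vtx (s := s)) := by
  intro a
  induction a with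
  | nil =>
    intro b h
    cases b with
    | nil => rfl
    | cons k b => exact absurd h.symm (child_ne_root _ _)
  | cons j a ih =>
    intro b h
    cases b with
    | nil => exact absurd h (child_ne_root _ _)
    | cons k b =>
      obtain ⟨h1, h2⟩ := child_inj.1 h
      rw [ih h1, h2]

theorem vtx_surjective [NeZero s] (v : Vertex s) : ∃ a, vtx a = v := by
  obtain ⟨n, hn⟩ : ∃ n, v.1 = n := ⟨_, rfl⟩
  induction n generalizing v with
  | zero =>
    rcases eq_root_or_child v with rfl | ⟨w, j, rfl⟩
    · exact ⟨[], rfl⟩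
    · exact absurd hn (Nat.succ_ne_zero _)
  | succ n ih =>
    rcases eq_root_or_child v with rfl | ⟨w, j, rfl⟩
    · exact absurd hn.symm (Nat.succ_ne_zero _)
    · obtain ⟨a, rfl⟩ := ih w (Nat.succ_injective hn)
      exact ⟨j :: a, rfl⟩

theorem wordS_child [NeZero s] (v : Vertex s) (j : Fin s) :
    wordS s (child v j) = genS s j * wordS s v := by
  have h : ∀ k, ofNat s (child v j).2 k = consDigit j (ofNat s v.2) k :=
    fun k => congrFun (ofNat_mul_add _ _) k
  change (List.ofFn fun k : Fin (v.1 + 1) => genS s (ofNat s (child v j).2 k)).prod = _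
  simp only [h]
  rw [List.ofFn_succ, List.prod_cons]
  rfl

theorem wordS_vtx [NeZero s] : ∀ a : List (Fin s), wordS s (vtx a) = word (genS s) a
  | [] => rfl
  | j :: a => by rw [vtx, wordS_child, wordS_vtx a, word_cons]

theorem word_genS_vtx [NeZero s] (a u : List (Fin s)) :
    word (genS s) a (basisVec s (vtx u)) = basisVec s (vtx (a ++ u)) := by
  induction a with
  | nil => rfl
  | cons j a ih => rw [word_cons, op_mul_apply, ih, genS_basisVec]; rfl

/-- The finite set of words of length less than `n`. -/
def shortWords (s : ℕ) : ℕ → Finset (List (Fin s))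
  | 0 => ∅
  | n + 1 => insert [] ((Finset.univ ×ˢ shortWords s n).image fun p => p.1 :: p.2)

theorem mem_shortWords {n : ℕ} {a : List (Fin s)} : a ∈ shortWords s n ↔ a.length < n := by
  induction n generalizing a with
  | zero => simp [shortWords]
  | succ n ih => cases a <;> simp [shortWords, ih]

theorem sum_shortWords_succ {M : Type*} [AddCommMonoid M] (n : ℕ) (g : List (Fin s) → M) :
    ∑ a ∈ shortWords s (n + 1), g a = g [] + ∑ j, ∑ a ∈ shortWords s n, g (j :: a) := by
  rw [shortWords, Finset.sum_insert (by simp), Finset.sum_image, Finset.sum_product]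
  rintro ⟨j, a⟩ - ⟨k, b⟩ - h
  simpa using h

variable [NeZero s]

/-- At most one `u` contributes. It is no longer than `v`, so cutting off at length `n` loses
nothing. -/
theorem star_word_genS_vtx {n : ℕ} (b : List (Fin s)) {v : List (Fin s)}
    (hv : v ∈ shortWords s n) :
    star (word (genS s) b) (basisVec s (vtx v)) =
      ∑ u ∈ shortWords s n, if b ++ u = v then basisVec s (vtx u) else 0 := by
  induction b generalizing v with
  | nil => simp [hv]
  | cons j b ih =>
    rw [word_cons, star_mul, op_mul_apply]
    cases v with
    | nil => simp [vtx, star_genS_root]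
    | cons k v =>
      have hv' : v ∈ shortWords s n := by
        rw [mem_shortWords] at hv ⊢
        exact lt_trans (by simp) hv
      rw [vtx, star_genS_child]
      by_cases h : j = k
      · simp [h, ih hv']
      · simp [h]

theorem inner_word_mul_star_word {n : ℕ} (a b w : List (Fin s)) {v : List (Fin s)}
    (hv : v ∈ shortWords s n) :
    inner ℂ (basisVec s (vtx w))
        ((word (genS s) a * star (word (genS s) b)) (basisVec s (vtx v))) =
      ∑ u ∈ shortWords s n, if a ++ u = w ∧ b ++ u = v then (1 : ℂ) else 0 := by
  rw [op_mul_apply, star_word_genS_vtx b hv, map_sum, inner_sum]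
  refine Finset.sum_congr rfl fun u _ => ?_
  by_cases h : b ++ u = v
  · simp only [h, if_true, word_genS_vtx, inner_basisVec, vtx_injective.eq_iff, and_true, eq_comm]
  · simp [h]

end Vertices

/-! ### The Poisson kernel -/

section Poisson

variable {s : ℕ} {D : Type*} [CStarAlgebra D] {r : Fin s → D}

/-- The endomorphism `x ↦ ∑ r_j x r_j⋆`. -/
def sumConj (hr : OrthIsometries r) : D →⋆ₙₐ[ℂ] D where
  toFun x := ∑ j, r j * x * star (r j)
  map_smul' c x := by simp [Finset.smul_sum]
  map_zero' := by simp
  map_add' x y := by simp [mul_add, add_mul, Finset.sum_add_distrib]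
  map_star' x := by simp [star_sum, mul_assoc]
  map_mul' x y := by
    rw [Finset.sum_mul_sum]
    refine Finset.sum_congr rfl fun j _ => ?_
    have h : ∀ k, r j * x * star (r j) * (r k * y * star (r k)) =
        if j = k then r j * (x * y) * star (r j) else 0 := fun k => by
      have : r j * x * star (r j) * (r k * y * star (r k)) =
          r j * x * (star (r j) * r k) * (y * star (r k)) := by simp only [mul_assoc]
      rw [this, hr j k]
      split_ifs with hjk
      · simp [hjk, mul_assoc]
      · simp
    simp [h]

theorem sumConj_apply (hr : OrthIsometries r) (x : D) :
    sumConj hr x = ∑ j, r j * x * star (r j) := rfl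

/-- The square root of `1 - t² ∑ r_j r_j⋆`. -/
def defect (hr : OrthIsometries r) (t : ℝ) : D :=
  1 - ((1 - Real.sqrt (1 - t ^ 2) : ℝ) : ℂ) • sumConj hr 1

theorem star_defect (hr : OrthIsometries r) (t : ℝ) : star (defect hr t) = defect hr t := by
  simp [defect, ← map_star]

/-- `Q = sumConj hr 1` is a projection, so with `c = √(1 - t²)` the square of `1 - (1 - c)Q` is `1 -
(1 - c²)Q`. -/
theorem defect_mul_self (hr : OrthIsometries r) {t : ℝ} (h0 : 0 ≤ t) (h1 : t ≤ 1) :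
    defect hr t * defect hr t = 1 - ((t ^ 2 : ℝ) : ℂ) • sumConj hr 1 := by
  have hq : sumConj hr 1 * sumConj hr 1 = sumConj hr 1 := by rw [← map_mul, one_mul]
  have hsq : Real.sqrt (1 - t ^ 2) ^ 2 = 1 - t ^ 2 := Real.sq_sqrt (by nlinarith)
  simp only [defect, sub_mul, mul_sub, one_mul, mul_one, smul_mul_smul_comm, hq]
  set c := Real.sqrt (1 - t ^ 2)
  have h : ((t ^ 2 : ℝ) : ℂ) = ((1 - c : ℝ) : ℂ) + ((1 - c : ℝ) : ℂ) -
      ((1 - c : ℝ) : ℂ) * ((1 - c : ℝ) : ℂ) := by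
    rw [← Complex.ofReal_add, ← Complex.ofReal_mul, ← Complex.ofReal_sub]
    congr 1
    linarith
  rw [h, sub_smul, add_smul]
  abel

/-- The entries `t ^ |a| r_a Δ` of the Poisson kernel. -/
def poissonVec (hr : OrthIsometries r) (t : ℝ) (a : List (Fin s)) : D :=
  ((t ^ a.length : ℝ) : ℂ) • (word r a * defect hr t)

theorem poissonVec_append (hr : OrthIsometries r) (t : ℝ) (a b u : List (Fin s)) :
    poissonVec hr t (a ++ u) * star (poissonVec hr t (b ++ u)) =
      ((t ^ (a.length + b.length) : ℝ) : ℂ) •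
        (word r a * (poissonVec hr t u * star (poissonVec hr t u)) * star (word r b)) := by
  simp only [poissonVec, List.length_append, word_append, star_smul, star_mul,
    mul_smul_comm, smul_mul_assoc, smul_smul, mul_assoc, RCLike.star_def, Complex.conj_ofReal]
  congr 1
  push_cast
  ring

/-- The partial sums of `∑ T_u T_u⋆`. -/
def poissonSum (hr : OrthIsometries r) (t : ℝ) (n : ℕ) : D :=
  ∑ u ∈ shortWords s n, poissonVec hr t u * star (poissonVec hr t u)

/-- Splitting off the empty word and sorting the others by first letter gives `G_{n+1} = 1 - t²Φ(1)
+ t²Φ(G_n)`, where `Φ` is `sumConj hr`. -/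
theorem one_sub_poissonSum_succ (hr : OrthIsometries r) {t : ℝ} (h0 : 0 ≤ t) (h1 : t ≤ 1) (n : ℕ) :
    1 - poissonSum hr t (n + 1) = ((t ^ 2 : ℝ) : ℂ) • sumConj hr (1 - poissonSum hr t n) := by
  have hnil : poissonVec hr t [] * star (poissonVec hr t []) =
      1 - ((t ^ 2 : ℝ) : ℂ) • sumConj hr 1 := by
    simp [poissonVec, star_defect, defect_mul_self hr h0 h1]
  have hcons : ∀ j u, poissonVec hr t (j :: u) * star (poissonVec hr t (j :: u)) =
      ((t ^ 2 : ℝ) : ℂ) • (r j * (poissonVec hr t u * star (poissonVec hr t u)) * star (r j)) :=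
    fun j u => by simpa using poissonVec_append hr t [j] [j] u
  rw [poissonSum, sum_shortWords_succ, hnil]
  simp only [hcons, ← Finset.smul_sum, ← Finset.mul_sum, ← Finset.sum_mul]
  change 1 - (1 - _ + _ • sumConj hr (poissonSum hr t n)) = _
  rw [map_sub, smul_sub]
  abel

/-- `sumConj hr` is a `*`-homomorphism, hence contractive, so the recursion gains `t²` at each step.
The factor `‖1‖` allows for `D = 0`. -/
theorem norm_one_sub_poissonSum_le (hr : OrthIsometries r) {t : ℝ} (h0 : 0 ≤ t) (h1 : t ≤ 1)
    (n : ℕ) : ‖1 - poissonSum hr t n‖ ≤ (t ^ 2) ^ n * ‖(1 : D)‖ := by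
  induction n with
  | zero => simp [poissonSum, shortWords]
  | succ n ih =>
    rw [one_sub_poissonSum_succ hr h0 h1, norm_smul, pow_succ' (t ^ 2) n, mul_assoc]
    refine mul_le_mul (by simp) ((NonUnitalStarAlgHom.norm_apply_le _ _).trans ih)
      (norm_nonneg _) (sq_nonneg t)

theorem tendsto_poissonSum (hr : OrthIsometries r) {t : ℝ} (h0 : 0 ≤ t) (h1 : t < 1) :
    Filter.Tendsto (poissonSum hr t) Filter.atTop (nhds 1) := by
  rw [tendsto_iff_norm_sub_tendsto_zero]
  refine squeeze_zero (fun _ => norm_nonneg _)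
    (fun n => (norm_sub_rev _ _).trans_le (norm_one_sub_poissonSum_le hr h0 h1.le n)) ?_
  simpa using (tendsto_pow_atTop_nhds_zero_of_lt_one (sq_nonneg t)
    (pow_lt_one₀ h0 h1 two_ne_zero)).mul_const ‖(1 : D)‖

/-- Contractivity of the truncated transform needs every partial sum to be at most `1`; the
recursion preserves positivity of `1 - G_n`. -/
theorem norm_poissonSum_le (hr : OrthIsometries r) {t : ℝ} (h0 : 0 ≤ t) (h1 : t ≤ 1) (n : ℕ) :
    ‖poissonSum hr t n‖ ≤ 1 := by
  let _ := CStarAlgebra.spectralOrder D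
  have _ := CStarAlgebra.spectralOrderedRing D
  have hG : 0 ≤ poissonSum hr t n := Finset.sum_nonneg fun u _ => mul_star_self_nonneg _
  rw [CStarAlgebra.norm_le_one_iff_of_nonneg _ hG, ← sub_nonneg]
  clear hG
  induction n with
  | zero => simp [poissonSum, shortWords]
  | succ n ih =>
    rw [one_sub_poissonSum_succ hr h0 h1, sumConj_apply, Finset.smul_sum]
    refine Finset.sum_nonneg fun j _ => ?_
    have : ((t ^ 2 : ℝ) : ℂ) • (r j * (1 - poissonSum hr t n) * star (r j)) =
        ((t : ℂ) • r j) * (1 - poissonSum hr t n) * star ((t : ℂ) • r j) := by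
      simp only [star_smul, RCLike.star_def, Complex.conj_ofReal, smul_mul_assoc, mul_smul_comm,
        smul_smul, sq, Complex.ofReal_mul]
    rw [this]
    exact star_right_conjugate_nonneg ih _

/-- The truncated Poisson transform of an operator. -/
def poissonMap (hr : OrthIsometries r) (t : ℝ) (n : ℕ) (A : Op s) : D :=
  ∑ w ∈ shortWords s n, ∑ v ∈ shortWords s n,
    inner ℂ (basisVec s (vtx w)) (A (basisVec s (vtx v))) •
      (poissonVec hr t w * star (poissonVec hr t v))

theorem norm_poissonMap_le (hr : OrthIsometries r) {t : ℝ} (h0 : 0 ≤ t) (h1 : t ≤ 1) (n : ℕ)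
    (A : Op s) : ‖poissonMap hr t n A‖ ≤ ‖A‖ := by
  have hE : Orthonormal ℂ fun a : shortWords s n => basisVec s (vtx (a : List (Fin s))) :=
    (orthonormal_basisVec s).comp _ (vtx_injective.comp Subtype.val_injective)
  have h := norm_sum_inner_smul_mul_star_le hE A
    (fun a : shortWords s n => poissonVec hr t a) (by
      rw [Finset.sum_coe_sort (shortWords s n)
        fun u => poissonVec hr t u * star (poissonVec hr t u)]
      exact norm_poissonSum_le hr h0 h1 n)
  rw [poissonMap, ← Finset.sum_coe_sort]
  simp_rw [← Finset.sum_coe_sort (shortWords s n)]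
  exact h

theorem poissonMap_sum_smul (hr : OrthIsometries r) (t : ℝ) (n : ℕ) {κ : Type*} (K : Finset κ)
    (c : κ → ℂ) (A : κ → Op s) :
    poissonMap hr t n (∑ k ∈ K, c k • A k) = ∑ k ∈ K, c k • poissonMap hr t n (A k) := by
  simp only [poissonMap, sum_apply, smul_apply, inner_sum, inner_smul_right, Finset.sum_smul,
    Finset.smul_sum, mul_smul]
  rw [Finset.sum_comm_cycle]

variable [NeZero s]

/-- `S_a S_b⋆` has matrix entries `1` exactly at the pairs `(au, bu)`. With this cutoff both words
are admitted precisely when `|u| < n`, so no boundary terms appear. -/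
theorem poissonMap_word (hr : OrthIsometries r) (t : ℝ) (a b : List (Fin s)) (n : ℕ) :
    poissonMap hr t (n + max a.length b.length) (word (genS s) a * star (word (genS s) b)) =
      ((t ^ (a.length + b.length) : ℝ) : ℂ) •
        (word r a * poissonSum hr t n * star (word r b)) := by
  set m := n + max a.length b.length with hm
  have hsub : shortWords s n ⊆ shortWords s m := fun u hu => by
    rw [mem_shortWords] at hu ⊢; omega
  have h1 : poissonMap hr t m (word (genS s) a * star (word (genS s) b)) =
      ∑ u ∈ shortWords s m, ∑ w ∈ shortWords s m, ∑ v ∈ shortWords s m,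
        (if a ++ u = w ∧ b ++ u = v then (1 : ℂ) else 0) •
          (poissonVec hr t w * star (poissonVec hr t v)) := by
    rw [Finset.sum_comm, poissonMap]
    refine Finset.sum_congr rfl fun w _ => ?_
    rw [Finset.sum_comm]
    refine Finset.sum_congr rfl fun v hv => ?_
    rw [inner_word_mul_star_word a b w hv, Finset.sum_smul]
  have h2 : ∀ u ∈ shortWords s m, (∑ w ∈ shortWords s m, ∑ v ∈ shortWords s m,
        (if a ++ u = w ∧ b ++ u = v then (1 : ℂ) else 0) •
          (poissonVec hr t w * star (poissonVec hr t v))) =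
      if u ∈ shortWords s n then
        poissonVec hr t (a ++ u) * star (poissonVec hr t (b ++ u)) else 0 := fun u _ => by
    simp only [ite_and, ite_smul, one_smul, zero_smul, Finset.sum_ite_irrel,
      Finset.sum_const_zero, Finset.sum_ite_eq]
    simp only [mem_shortWords, List.length_append]
    by_cases hu : u.length < n
    · rw [if_pos (by omega), if_pos (by omega), if_pos hu]
    · rw [if_neg hu, ← ite_and, if_neg (by omega)]
  rw [h1, Finset.sum_congr rfl h2, ← Finset.sum_filter, Finset.filter_mem_eq_inter,
    Finset.inter_eq_right.2 hsub]
  simp only [poissonVec_append, ← Finset.smul_sum, ← Finset.mul_sum, ← Finset.sum_mul]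
  rfl

theorem tendsto_poissonMap_word (hr : OrthIsometries r) {t : ℝ} (h0 : 0 ≤ t) (h1 : t < 1)
    (a b : List (Fin s)) :
    Filter.Tendsto
      (fun n => poissonMap hr t n (word (genS s) a * star (word (genS s) b))) Filter.atTop
      (nhds (((t ^ (a.length + b.length) : ℝ) : ℂ) • (word r a * star (word r b)))) := by
  rw [← Filter.tendsto_add_atTop_iff_nat (max a.length b.length)]
  simp only [poissonMap_word]
  simpa using (((tendsto_poissonSum hr h0 h1).const_mul (word r a)).mul_const
    (star (word r b))).const_smul (((t ^ (a.length + b.length) : ℝ) : ℂ))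

/-- The algebra of the `S_j` dominates every family of isometries with orthogonal ranges. -/
theorem norm_sum_word_le (hr : OrthIsometries r) (K : Finset (List (Fin s) × List (Fin s)))
    (c : List (Fin s) × List (Fin s) → ℂ) :
    ‖∑ p ∈ K, c p • (word r p.1 * star (word r p.2))‖ ≤
      ‖∑ p ∈ K, c p • (word (genS s) p.1 * star (word (genS s) p.2))‖ := by
  -- The radius `1` is reached only as a limit: if `∑ r_j r_j⋆ = 1`, the defect at `t = 1` vanishes
  -- and with it the whole kernel.
  have h : ∀ t ∈ Set.Ico (0 : ℝ) 1,
      ‖∑ p ∈ K, c p • (((t ^ (p.1.length + p.2.length) : ℝ) : ℂ) •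
        (word r p.1 * star (word r p.2)))‖ ≤
      ‖∑ p ∈ K, c p • (word (genS s) p.1 * star (word (genS s) p.2))‖ := fun t ht => by
    refine le_of_tendsto ((tendsto_finsetSum K fun p _ =>
      (tendsto_poissonMap_word hr ht.1 ht.2 p.1 p.2).const_smul (c p)).norm)
      (Filter.Eventually.of_forall fun n => ?_)
    rw [← poissonMap_sum_smul]
    exact norm_poissonMap_le hr ht.1 ht.2.le n _
  have hcont : Continuous fun t : ℝ => ‖∑ p ∈ K, c p •
      (((t ^ (p.1.length + p.2.length) : ℝ) : ℂ) • (word r p.1 * star (word r p.2)))‖ := by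
    fun_prop
  have hmem : (1 : ℝ) ∈ closure (Set.Ico (0 : ℝ) 1) := by
    rw [closure_Ico zero_ne_one]; simp
  simpa using le_on_closure h hcont.continuousOn continuousOn_const hmem

end Poisson

/-! ### Universality of the algebra of the `S_j` -/

/-- Passes from generation inside `A` to generation of `B` as an algebra of its own: `B` is closed,
so the image of a closed subalgebra of `B` is closed in `A`. -/
theorem cstarGen_eq_top_of_subtype {A : Type u} [CStarAlgebra A] {B : StarSubalgebra ℂ A}
    [hB : IsClosed (B : Set A)] {X : Set A} (hX : B ≤ cstarGen X) {Y : Set B}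
    (hY : X ⊆ (Subtype.val '' (cstarGen Y : Set B))) : cstarGen Y = ⊤ := by
  refine eq_top_iff.2 fun b _ => ?_
  let K : StarSubalgebra ℂ A := (cstarGen Y).map B.subtype
  have hK : (K : Set A) = Subtype.val '' (cstarGen Y : Set B) := rfl
  have hKc : IsClosed (K : Set A) := by
    rw [hK]
    exact hB.isClosedEmbedding_subtypeVal.isClosedMap _
      (StarSubalgebra.isClosed_topologicalClosure _)
  have h : (b : A) ∈ K := cstarGen_le hKc (hK ▸ hY) (hX b.2)
  obtain ⟨c, hc, hcb⟩ := h
  rwa [← Subtype.ext hcb]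

theorem starAlgHom_eqOn_cstarGen {A : Type u} {B : Type v} [CStarAlgebra A] [CStarAlgebra B]
    {φ ψ : A →⋆ₐ[ℂ] B} {X : Set A} (h : ∀ x ∈ X, φ x = ψ x) {a : A} (ha : a ∈ cstarGen X) :
    φ a = ψ a :=
  cstarGen_le (B := StarAlgHom.equalizer φ ψ)
    (isClosed_eq (continuous_starAlgHom φ) (continuous_starAlgHom ψ)) h ha

theorem starAlgHom_ext {A : Type u} {B : Type v} [CStarAlgebra A] [CStarAlgebra B]
    {φ ψ : A →⋆ₐ[ℂ] B} {X : Set A} (hX : cstarGen X = ⊤) (h : ∀ x ∈ X, φ x = ψ x) : φ = ψ :=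
  StarAlgHom.ext fun _ => starAlgHom_eqOn_cstarGen h (hX ▸ trivial)

section Universal

variable {s : ℕ} [NeZero s] {D : Type u} [CStarAlgebra D] {r : Fin s → D}

theorem norm_snd_le_of_mem_cstarGen (hr : OrthIsometries r) {x : Op s × D}
    (hx : x ∈ cstarGen (Set.range fun j => (genS s j, r j))) : ‖x.2‖ ≤ ‖x.1‖ := by
  have hp : OrthIsometries fun j => (genS s j, r j) := fun j k => by
    rw [Prod.star_def, Prod.mk_mul_mk, orthIsometries_genS j k, hr j k]
    split_ifs <;> rfl
  have hw : ∀ a, word (fun j => (genS s j, r j)) a = (word (genS s) a, word r a) := fun a => by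
    induction a with
    | nil => rfl
    | cons j a ih => simp [ih]
  refine closure_minimal (fun y hy => ?_) (isClosed_le continuous_snd.norm continuous_fst.norm)
    (hp.mem_closure_wordSpan hx)
  obtain ⟨c, hc⟩ := (Finsupp.mem_span_range_iff_exists_finsupp).1 hy
  have h1 : y.1 = ∑ p ∈ c.support, c p • (word (genS s) p.1 * star (word (genS s) p.2)) := by
    rw [← hc]
    simp [Finsupp.sum, Prod.fst_sum, hw]
  have h2 : y.2 = ∑ p ∈ c.support, c p • (word r p.1 * star (word r p.2)) := by
    rw [← hc]
    simp [Finsupp.sum, Prod.snd_sum, hw]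
  change ‖y.2‖ ≤ ‖y.1‖
  rw [h1, h2]
  exact norm_sum_word_le hr c.support c

/-- On the algebra generated by the pairs `(S_j, r_j)`, the first projection is injective by the
norm estimate, hence isometric with closed range. Its inverse followed by the second projection is
the homomorphism. -/
theorem exists_starAlgHom (hr : OrthIsometries r) :
    ∃ φ : shiftAlgebra s →⋆ₐ[ℂ] D, ∀ j, φ ⟨genS s j, genS_mem s j⟩ = r j := by
  let C : StarSubalgebra ℂ (Op s × D) := cstarGen (Set.range fun j => (genS s j, r j))
  let f : C →⋆ₐ[ℂ] Op s := (StarAlgHom.fst ℂ (Op s) D).comp C.subtype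
  have hf : Function.Injective f := by
    refine (injective_iff_map_eq_zero f).2 fun x hx => Subtype.ext (Prod.ext hx ?_)
    have h := norm_snd_le_of_mem_cstarGen hr x.2
    have hx' : (x : Op s × D).1 = 0 := hx
    rw [hx', norm_zero] at h
    exact norm_le_zero_iff.1 h
  have hcl : IsClosed (f.range : Set (Op s)) := by
    change IsClosed (Set.range f)
    exact (NonUnitalStarAlgHom.isometry f hf).isClosedEmbedding.isClosed_range
  have hmem : ∀ j, (genS s j, r j) ∈ C := fun j => subset_cstarGen _ ⟨j, rfl⟩
  have hle : shiftAlgebra s ≤ f.range := by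
    rw [shiftAlgebra_eq]
    refine cstarGen_le hcl ?_
    rintro _ ⟨j, rfl⟩
    exact ⟨⟨_, hmem j⟩, rfl⟩
  let e := StarAlgEquiv.ofInjective f hf
  refine ⟨(((StarAlgHom.snd ℂ (Op s) D).comp C.subtype).comp
    (e.symm : f.range →⋆ₐ[ℂ] C)).comp (StarSubalgebra.inclusion hle), fun j => ?_⟩
  have h : e.symm (StarSubalgebra.inclusion hle ⟨genS s j, genS_mem s j⟩) = ⟨_, hmem j⟩ := by
    rw [StarAlgEquiv.symm_apply_eq]
    rfl
  change (e.symm (StarSubalgebra.inclusion hle ⟨genS s j, genS_mem s j⟩) : Op s × D).2 = r j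
  rw [h]

theorem cstarGen_genS_eq_top : cstarGen (Set.range fun j =>
    (⟨genS s j, genS_mem s j⟩ : shiftAlgebra s)) = ⊤ := by
  refine cstarGen_eq_top_of_subtype shiftAlgebra_eq.le ?_
  rintro _ ⟨j, rfl⟩
  exact ⟨_, subset_cstarGen _ ⟨j, rfl⟩, rfl⟩

theorem isCuntzToeplitz_shiftAlgebra : IsCuntzToeplitz.{0, u} s
    (fun j => (⟨genS s j, genS_mem s j⟩ : shiftAlgebra s)) where
  relations j k := by
    refine Subtype.ext ((orthIsometries_genS j k).trans ?_)
    split_ifs <;> rfl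
  generates := cstarGen_genS_eq_top
  universal D _ r hr := by
    obtain ⟨φ, hφ⟩ := exists_starAlgHom hr
    refine ⟨φ, hφ, fun ψ hψ => starAlgHom_ext cstarGen_genS_eq_top ?_⟩
    rintro _ ⟨j, rfl⟩
    exact (hψ j).trans (hφ j).symm

end Universal

/-! ### The gauge action -/

section Gauge

variable {s : ℕ}

theorem gaugeU_basisVec (θ : ℝ) (v : Vertex s) : gaugeU s θ (basisVec s v) =
    Complex.exp (((2 * Real.pi * v.1 * θ : ℝ) : ℂ) * Complex.I) • basisVec s v :=
  diag_basisVec _ _ _ _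

theorem gaugeU_mul_neg (θ : ℝ) : gaugeU s θ * gaugeU s (-θ) = 1 := by
  refine op_ext fun v => ?_
  rw [op_mul_apply, gaugeU_basisVec, map_smul, gaugeU_basisVec, smul_smul, ← Complex.exp_add]
  simp

theorem star_gaugeU (θ : ℝ) : star (gaugeU s θ) = gaugeU s (-θ) := by
  refine op_ext fun v => eq_of_inner_basisVec fun w => ?_
  rw [ContinuousLinearMap.star_eq_adjoint, ContinuousLinearMap.adjoint_inner_right,
    gaugeU_basisVec, gaugeU_basisVec, inner_smul_left, inner_smul_right, inner_basisVec]
  split_ifs with h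
  · rw [h, ← Complex.exp_conj, map_mul, Complex.conj_ofReal, Complex.conj_I]
    congr 2
    push_cast
    ring
  · simp

/-- The gauge action by `*`-endomorphisms. -/
def gaugeHom (s : ℕ) (θ : ℝ) : Op s →⋆ₐ[ℂ] Op s where
  toFun := gauge s θ
  map_one' := by simp [gauge, gaugeU_mul_neg]
  map_mul' a b := by
    have h : gaugeU s (-θ) * gaugeU s θ = 1 := by simpa using gaugeU_mul_neg (s := s) (-θ)
    calc gauge s θ (a * b) = gaugeU s θ * a * (gaugeU s (-θ) * gaugeU s θ) * b * gaugeU s (-θ) := by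
          simp [h, gauge, mul_assoc]
      _ = _ := by simp only [gauge, mul_assoc]
  map_zero' := by simp [gauge]
  map_add' a b := by simp [gauge, mul_add, add_mul]
  commutes' c := by
    simp [gauge, Algebra.algebraMap_eq_smul_one, gaugeU_mul_neg]
  map_star' a := by
    simp [gauge, star_gaugeU, mul_assoc]

/-- The phase `e^{2π i θ}`. -/
def phase (θ : ℝ) : ℂ := Complex.exp (((2 * Real.pi * θ : ℝ) : ℂ) * Complex.I)

theorem phase_mul_conj (θ : ℝ) : phase θ * star (phase θ) = 1 := by
  rw [RCLike.star_def, Complex.mul_conj, Complex.normSq_eq_norm_sq, phase,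
    Complex.norm_exp_ofReal_mul_I]
  simp

/-- The average of an operator over the gauge action of the `n`-th roots of unity. -/
def gaugeAvg (n : ℕ) (a : Op s) : Op s :=
  (n : ℂ)⁻¹ • ∑ k ∈ Finset.range n, gaugeHom s (k / n) a

theorem norm_gaugeAvg_le (n : ℕ) (a : Op s) : ‖gaugeAvg n a‖ ≤ ‖a‖ := by
  rcases Nat.eq_zero_or_pos n with rfl | hn
  · simp [gaugeAvg]
  · rw [gaugeAvg, norm_smul, norm_inv, Complex.norm_natCast, inv_mul_le_iff₀ (by positivity)]
    refine (norm_sum_le_of_le _ fun k _ => NonUnitalStarAlgHom.norm_apply_le _ a).trans ?_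
    simp

variable [NeZero s]

theorem gaugeHom_genS (θ : ℝ) (j : Fin s) : gaugeHom s θ (genS s j) = phase θ • genS s j := by
  refine op_ext fun v => ?_
  change gaugeU s θ (genS s j (gaugeU s (-θ) (basisVec s v))) = phase θ • genS s j (basisVec s v)
  rw [gaugeU_basisVec, map_smul, genS_basisVec, map_smul, gaugeU_basisVec, smul_smul,
    ← Complex.exp_add, phase]
  congr 2
  simp only [child]
  push_cast
  ring

theorem gaugeHom_shift (θ : ℝ) : gaugeHom s θ (shift s) = phase θ • shift s := by
  rw [shift_eq_sum, map_smul, map_sum, smul_comm]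
  simp only [gaugeHom_genS, Finset.smul_sum]

theorem gaugeHom_word (θ : ℝ) (a : List (Fin s)) :
    gaugeHom s θ (word (genS s) a) = phase θ ^ a.length • word (genS s) a := by
  induction a with
  | nil => simp
  | cons j a ih =>
    rw [word_cons, map_mul, ih, gaugeHom_genS, smul_mul_smul_comm, List.length_cons, pow_succ']

theorem gaugeHom_word_mul_star (θ : ℝ) (a b : List (Fin s)) :
    gaugeHom s θ (word (genS s) a * star (word (genS s) b)) =
      (phase θ ^ a.length * star (phase θ) ^ b.length) •
        (word (genS s) a * star (word (genS s) b)) := by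
  rw [map_mul, map_star, gaugeHom_word, gaugeHom_word, star_smul, smul_mul_smul_comm, star_pow]

theorem word_mul_star_mem_coeffAlgebra {a b : List (Fin s)} (h : a.length = b.length) :
    word (genS s) a * star (word (genS s) b) ∈ coeffAlgebra s := by
  have hx : ∀ (n : ℕ) (a : List (Fin s)), a.length = n →
      ∃ x : Fin (s ^ n), wordS s ⟨n, x⟩ = word (genS s) a := by
    rintro n a rfl
    rw [← wordS_vtx, ← vtx_fst]
    exact ⟨_, rfl⟩
  obtain ⟨x, hx1⟩ := hx b.length a h
  obtain ⟨y, hy⟩ := hx b.length b rfl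
  exact subset_cstarGen _ ⟨_, x, y, by rw [hx1, hy]⟩

theorem gaugeHom_of_mem_coeffAlgebra {a : Op s} (ha : a ∈ coeffAlgebra s) (θ : ℝ) :
    gaugeHom s θ a = a := by
  refine starAlgHom_eqOn_cstarGen (ψ := StarAlgHom.id ℂ (Op s)) ?_ ha
  rintro _ ⟨n, x, y, rfl⟩
  obtain ⟨a, ha⟩ := vtx_surjective (⟨n, x⟩ : Vertex s)
  obtain ⟨b, hb⟩ := vtx_surjective (⟨n, y⟩ : Vertex s)
  have hab : a.length = b.length := by rw [← vtx_fst, ← vtx_fst, ha, hb]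
  rw [← ha, ← hb, wordS_vtx, wordS_vtx, gaugeHom_word_mul_star, hab, ← mul_pow, phase_mul_conj]
  simp

/-- The word has weight `|a| - |b|`, of absolute value below `n`. If the weight is nonzero, a
primitive `n`-th root of unity detects it and the geometric sum vanishes; a finite average thus
replaces the integral over the circle. -/
theorem gaugeAvg_word_mul_star_mem {n : ℕ} {a b : List (Fin s)} (ha : a.length < n)
    (hb : b.length < n) :
    gaugeAvg n (word (genS s) a * star (word (genS s) b)) ∈ coeffAlgebra s := by
  simp only [gaugeAvg, gaugeHom_word_mul_star, ← Finset.sum_smul]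
  refine SMulMemClass.smul_mem _ ?_
  by_cases hab : a.length = b.length
  · exact SMulMemClass.smul_mem _ (word_mul_star_mem_coeffAlgebra hab)
  · have hn : n ≠ 0 := by omega
    have hprim : IsPrimitiveRoot (phase (1 / n)) n := by
      have h : phase (1 / n) = Complex.exp (2 * Real.pi * Complex.I / n) := by
        rw [phase]
        congr 1
        push_cast
        ring
      exact h ▸ Complex.isPrimitiveRoot_exp n hn
    have hk : ∀ k : ℕ, phase (k / n) = phase (1 / n) ^ k := fun k => by
      rw [phase, phase, ← Complex.exp_nat_mul]
      congr 1
      push_cast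
      ring
    set ζ := phase (1 / n) with hζ
    have hζ1 : ζ * star ζ = 1 := phase_mul_conj _
    have hne : ζ ^ a.length * star ζ ^ b.length ≠ 1 := fun h => by
      refine hab (hprim.pow_inj ha hb ?_)
      calc ζ ^ a.length = ζ ^ a.length * (ζ * star ζ) ^ b.length := by rw [hζ1]; simp
        _ = ζ ^ a.length * star ζ ^ b.length * ζ ^ b.length := by rw [mul_pow]; ring
        _ = ζ ^ b.length := by rw [h, one_mul]
    have hsum : ∑ k ∈ Finset.range n,
        phase (k / n) ^ a.length * star (phase (k / n)) ^ b.length = 0 := by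
      have h1 : ∀ k : ℕ, phase (k / n) ^ a.length * star (phase (k / n)) ^ b.length =
          (ζ ^ a.length * star ζ ^ b.length) ^ k := fun k => by
        rw [hk, star_pow]; ring
      simp only [h1]
      have h2 : (ζ ^ a.length * star ζ ^ b.length) ^ n = 1 := by
        have h3 : star ζ ^ n = 1 := by rw [← star_pow, hprim.pow_eq_one, star_one]
        rw [mul_pow, ← pow_mul, ← pow_mul, mul_comm a.length, mul_comm b.length, pow_mul,
          pow_mul, hprim.pow_eq_one, h3, one_pow, one_pow, one_mul]
      rw [geom_sum_eq hne, h2, sub_self, zero_div]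
    rw [hsum, zero_smul]
    exact zero_mem _

theorem eventually_gaugeAvg_mem {a : Op s} (ha : a ∈ wordSpan (genS s)) :
    ∀ᶠ n in Filter.atTop, gaugeAvg n a ∈ coeffAlgebra s := by
  induction ha using Submodule.span_induction with
  | mem x hx =>
    obtain ⟨⟨a, b⟩, rfl⟩ := hx
    filter_upwards [Filter.eventually_gt_atTop a.length, Filter.eventually_gt_atTop b.length]
      with n ha hb using gaugeAvg_word_mul_star_mem ha hb
  | zero => simp [gaugeAvg]
  | add x y _ _ hx hy =>
    filter_upwards [hx, hy] with n hx hy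
    have : gaugeAvg n (x + y) = gaugeAvg n x + gaugeAvg n y := by
      simp [gaugeAvg, Finset.sum_add_distrib]
    rw [this]
    exact add_mem hx hy
  | smul c x _ hx =>
    filter_upwards [hx] with n hx
    have : gaugeAvg n (c • x) = c • gaugeAvg n x := by
      simp only [gaugeAvg, map_smul, ← Finset.smul_sum]
      rw [smul_comm]
    rw [this]
    exact SMulMemClass.smul_mem _ hx

/-- Averaging fixes `a`, is contractive, and eventually moves an approximant from the word span into
`B_S` without increasing its distance to `a`. -/
theorem mem_coeffAlgebra_of_gaugeHom {a : Op s} (ha : a ∈ shiftAlgebra s)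
    (h : ∀ θ, gaugeHom s θ a = a) : a ∈ coeffAlgebra s := by
  have hcl : IsClosed (coeffAlgebra s : Set (Op s)) := inferInstance
  rw [← SetLike.mem_coe, ← hcl.closure_eq, Metric.mem_closure_iff]
  intro ε hε
  rw [shiftAlgebra_eq] at ha
  obtain ⟨b, hb, hab⟩ :=
    Metric.mem_closure_iff.1 (orthIsometries_genS.mem_closure_wordSpan ha) ε hε
  obtain ⟨n, hn, hn0⟩ := ((eventually_gaugeAvg_mem hb).and (Filter.eventually_gt_atTop 0)).exists
  refine ⟨gaugeAvg n b, hn, ?_⟩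
  have h1 : a - gaugeAvg n b = gaugeAvg n (a - b) := by
    have h2 : (n : ℂ) ≠ 0 := by exact_mod_cast hn0.ne'
    simp only [gaugeAvg, map_sub, h, Finset.sum_sub_distrib, smul_sub, Finset.sum_const,
      Finset.card_range, ← Nat.cast_smul_eq_nsmul ℂ, smul_smul, inv_mul_cancel₀ h2, one_smul]
  rw [dist_eq_norm, h1]
  rw [dist_eq_norm] at hab
  exact (norm_gaugeAvg_le n _).trans_lt hab

theorem coeffAlgebra_eq : (coeffAlgebra s : Set (Op s)) =
    {a | a ∈ shiftAlgebra s ∧ ∀ θ : ℝ, gauge s θ a = a} :=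
  Set.ext fun _ => ⟨fun ha => ⟨coeffAlgebra_le s ha, gaugeHom_of_mem_coeffAlgebra ha⟩,
    fun ha => mem_coeffAlgebra_of_gaugeHom ha.1 ha.2⟩

end Gauge

/-! ### Conjugation by the Bernoulli shift -/

section Shift

variable {s : ℕ} [NeZero s]

theorem smul_inv_sqrt_smul {M : Type*} [AddCommGroup M] [Module ℂ M] (x : M) :
    (s : ℂ) • ((1 / Real.sqrt s : ℝ) : ℂ) • ((1 / Real.sqrt s : ℝ) : ℂ) • x = x := by
  have hs : (s : ℂ) = ((Real.sqrt s : ℝ) : ℂ) * ((Real.sqrt s : ℝ) : ℂ) := by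
    rw [← Complex.ofReal_mul, Real.mul_self_sqrt (Nat.cast_nonneg s), Complex.ofReal_natCast]
  have h := sqrt_mul_inv_sqrt (s := s)
  have : (s : ℂ) * ((1 / Real.sqrt s : ℝ) : ℂ) * ((1 / Real.sqrt s : ℝ) : ℂ) = 1 := by
    rw [hs, mul_assoc, mul_mul_mul_comm, h, one_mul]
  rw [smul_smul, smul_smul, this, one_smul]

theorem star_shift_mul_genS (j : Fin s) :
    star (shift s) * genS s j = ((1 / Real.sqrt s : ℝ) : ℂ) • 1 := by
  rw [shift_eq_sum, star_smul, star_sum, smul_mul_assoc, Finset.sum_mul, RCLike.star_def,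
    Complex.conj_ofReal]
  simp [orthIsometries_genS _ j]

theorem star_genS_mul_shift (j : Fin s) :
    star (genS s j) * shift s = ((1 / Real.sqrt s : ℝ) : ℂ) • 1 := by
  have h := congrArg star (star_shift_mul_genS j)
  rwa [star_mul, star_star, star_smul, star_one, RCLike.star_def, Complex.conj_ofReal] at h

theorem star_shift_mul_shift : star (shift s) * shift s = 1 := by
  conv_lhs => rw [shift_eq_sum, mul_smul_comm, Finset.mul_sum, ← shift_eq_sum]
  simp only [star_shift_mul_genS, Finset.sum_const, Finset.card_univ, Fintype.card_fin,
    ← Nat.cast_smul_eq_nsmul ℂ]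
  rw [smul_comm, smul_inv_sqrt_smul]

theorem sqrt_smul_shift : ((Real.sqrt s : ℝ) : ℂ) • shift s = ∑ j, genS s j := by
  rw [shift_eq_sum, smul_smul, sqrt_mul_inv_sqrt, one_smul]

/-- The phases of `S` and `S⋆` cancel, so the element is gauge invariant, and no computation with
words is needed. -/
theorem shift_conj_mem {b : Op s} (hb : b ∈ coeffAlgebra s) :
    shift s * b * star (shift s) ∈ coeffAlgebra s := by
  refine mem_coeffAlgebra_of_gaugeHom (mul_mem (mul_mem (shift_mem s) (coeffAlgebra_le s hb))
    (star_mem (shift_mem s))) fun θ => ?_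
  rw [map_mul, map_mul, map_star, gaugeHom_shift, gaugeHom_of_mem_coeffAlgebra hb, star_smul,
    smul_mul_assoc, smul_mul_smul_comm, phase_mul_conj, one_smul]

theorem star_shift_conj_mem {b : Op s} (hb : b ∈ coeffAlgebra s) :
    star (shift s) * b * shift s ∈ coeffAlgebra s := by
  refine mem_coeffAlgebra_of_gaugeHom (mul_mem (mul_mem (star_mem (shift_mem s))
    (coeffAlgebra_le s hb)) (shift_mem s)) fun θ => ?_
  rw [map_mul, map_mul, map_star, gaugeHom_shift, gaugeHom_of_mem_coeffAlgebra hb, star_smul,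
    smul_mul_assoc, smul_mul_smul_comm, mul_comm, phase_mul_conj, one_smul]

/-- The endomorphism `b ↦ S b S⋆` of `B_S`. -/
def shiftEndo (s : ℕ) [NeZero s] : coeffAlgebra s →⋆ₙₐ[ℂ] coeffAlgebra s where
  toFun b := ⟨shift s * b * star (shift s), shift_conj_mem b.2⟩
  map_smul' c b := Subtype.ext (by simp)
  map_zero' := Subtype.ext (by simp)
  map_add' a b := Subtype.ext (by simp [mul_add, add_mul])
  map_star' b := Subtype.ext (by simp [mul_assoc])
  map_mul' a b := Subtype.ext <| by
    calc shift s * (a * b) * star (shift s)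
        = shift s * a * (star (shift s) * shift s) * b * star (shift s) := by
          rw [star_shift_mul_shift, mul_one, mul_assoc (shift s) (a : Op s)]
      _ = (shift s * a * star (shift s)) * (shift s * b * star (shift s)) := by
          simp only [mul_assoc]

/-- The compression `b ↦ S⋆ b S` of `B_S`. -/
def shiftTransfer (b : coeffAlgebra s) : coeffAlgebra s :=
  ⟨star (shift s) * b * shift s, star_shift_conj_mem b.2⟩

theorem shiftEndo_coe (b : coeffAlgebra s) :
    (shiftEndo s b : Op s) = shift s * b * star (shift s) := rfl

theorem shiftTransfer_shiftEndo (b : coeffAlgebra s) : shiftTransfer (shiftEndo s b) = b :=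
  Subtype.ext <| by
    calc star (shift s) * (shift s * b * star (shift s)) * shift s
        = (star (shift s) * shift s) * b * (star (shift s) * shift s) := by simp only [mul_assoc]
      _ = b := by rw [star_shift_mul_shift, one_mul, mul_one]

/-- Both sides are `SS⋆ b SS⋆`. This puts the whole corner in the range and lets covariance
determine `V⋆ π(b) V`. -/
theorem shiftEndo_shiftTransfer (b : coeffAlgebra s) :
    shiftEndo s (shiftTransfer b) = shiftEndo s 1 * b * shiftEndo s 1 :=
  Subtype.ext <| by
    simp only [MulMemClass.coe_mul, shiftEndo_coe, shiftTransfer, OneMemClass.coe_one, mul_one,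
      mul_assoc]

theorem shiftEndo_injective : Function.Injective (shiftEndo s) :=
  Function.LeftInverse.injective shiftTransfer_shiftEndo

theorem range_shiftEndo :
    Set.range (shiftEndo s) = {x | ∃ b, x = shiftEndo s 1 * b * shiftEndo s 1} := by
  refine Set.ext fun x => ⟨?_, ?_⟩
  · rintro ⟨b, rfl⟩
    exact ⟨shiftEndo s b, by rw [← map_mul, ← map_mul, one_mul, mul_one]⟩
  · rintro ⟨b, rfl⟩
    exact ⟨_, shiftEndo_shiftTransfer b⟩

/-! ### The crossed product -/

/-- The element `S_j S_k⋆` of `B_S`. -/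
def unitB (j k : Fin s) : coeffAlgebra s :=
  ⟨genS s j * star (genS s k), by
    simpa using word_mul_star_mem_coeffAlgebra (s := s) (a := [j]) (b := [k]) rfl⟩

theorem star_unitB (j k : Fin s) : star (unitB j k) = unitB k j :=
  Subtype.ext (by simp [unitB])

theorem shiftTransfer_unitB (i j k l : Fin s) : shiftTransfer (unitB i j * unitB k l) =
    if j = k then ((1 / Real.sqrt s : ℝ) : ℂ) • ((1 / Real.sqrt s : ℝ) : ℂ) • 1 else 0 := by
  refine Subtype.ext ?_
  have h : (shiftTransfer (unitB i j * unitB k l) : Op s) =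
      (star (shift s) * genS s i) * (star (genS s j) * genS s k) *
        (star (genS s l) * shift s) := by
    simp only [shiftTransfer, unitB, MulMemClass.coe_mul, mul_assoc]
  rw [h, star_shift_mul_genS, star_genS_mul_shift, orthIsometries_genS j k]
  split_ifs
  · simp
  · simp

theorem sum_unitB_mul_shiftEndo_one (k : Fin s) :
    (∑ j, unitB j k) * shiftEndo s 1 = shiftEndo s 1 := by
  refine Subtype.ext ?_
  calc ((∑ j, unitB j k : coeffAlgebra s) : Op s) * (shift s * (1 : Op s) * star (shift s))
      = (∑ j, genS s j) * (star (genS s k) * shift s) * star (shift s) := by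
        rw [AddSubmonoidClass.coe_finsetSum]
        simp only [unitB, ← Finset.sum_mul, mul_one, mul_assoc]
    _ = shift s * (1 : Op s) * star (shift s) := by
        rw [← sqrt_smul_shift, star_genS_mul_shift, smul_mul_smul_comm, sqrt_mul_inv_sqrt, one_smul]

/-- Writes `S_j y S_k⋆` using only `B_S` and the endomorphism, so that a covariant pair controls it.
The factor `s` offsets `S_i⋆S` and `S⋆S_i`, each `1/√s`. -/
theorem smul_unitB_mul_shiftEndo_mul_unitB (j k i : Fin s) (y : coeffAlgebra s) :
    (((s : ℂ) • (unitB j i * shiftEndo s y * unitB i k) : coeffAlgebra s) : Op s) =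
      genS s j * y * star (genS s k) := by
  calc (s : ℂ) • (genS s j * star (genS s i) * (shift s * y * star (shift s)) *
        (genS s i * star (genS s k)))
      = (s : ℂ) • (genS s j * (star (genS s i) * shift s) * y * (star (shift s) * genS s i) *
        star (genS s k)) := by simp only [mul_assoc]
    _ = _ := by
        rw [star_genS_mul_shift, star_shift_mul_genS]
        simp only [mul_smul_comm, smul_mul_assoc, mul_one, smul_inv_sqrt_smul]

theorem generates_crossedProduct :
    cstarGen (Set.range (StarSubalgebra.inclusion (coeffAlgebra_le s)) ∪
      {(⟨shift s, shift_mem s⟩ : shiftAlgebra s)}) = ⊤ := by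
  refine cstarGen_eq_top_of_subtype shiftAlgebra_eq.le ?_
  rintro _ ⟨j, rfl⟩
  -- The generator is recovered as `S_j = √s (S_j S_j⋆) S`.
  refine ⟨((Real.sqrt s : ℝ) : ℂ) •
    (StarSubalgebra.inclusion (coeffAlgebra_le s) (unitB j j) * ⟨shift s, shift_mem s⟩),
    SMulMemClass.smul_mem _ (mul_mem (subset_cstarGen _ (Or.inl ⟨_, rfl⟩))
      (subset_cstarGen _ (Or.inr rfl))), ?_⟩
  change ((Real.sqrt s : ℝ) : ℂ) • (genS s j * star (genS s j) * shift s) = genS s j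
  rw [mul_assoc, star_genS_mul_shift, mul_smul_comm, mul_one, smul_smul, sqrt_mul_inv_sqrt,
    one_smul]

theorem coe_inclusion {A : Type u} [CStarAlgebra A] {B C : StarSubalgebra ℂ A} (h : B ≤ C)
    (b : B) : (StarSubalgebra.inclusion h b : A) = b := rfl

theorem isCovariant_shift : IsCovariant (shiftEndo s)
    (StarSubalgebra.inclusion (coeffAlgebra_le s)) (⟨shift s, shift_mem s⟩ : shiftAlgebra s) where
  isometry := Subtype.ext star_shift_mul_shift
  covariant b := Subtype.ext <| by
    rw [MulMemClass.coe_mul, MulMemClass.coe_mul, StarMemClass.coe_star, coe_inclusion,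
      coe_inclusion, shiftEndo_coe]

theorem cstarGen_coeffAlgebra_eq_top : cstarGen {b : coeffAlgebra s |
    ∃ c d : List (Fin s), c.length = d.length ∧
      (b : Op s) = word (genS s) c * star (word (genS s) d)} = ⊤ := by
  refine cstarGen_eq_top_of_subtype (le_refl (coeffAlgebra s)) ?_
  rintro _ ⟨n, x, y, rfl⟩
  obtain ⟨c, hc⟩ := vtx_surjective (⟨n, x⟩ : Vertex s)
  obtain ⟨d, hd⟩ := vtx_surjective (⟨n, y⟩ : Vertex s)
  have hcd : c.length = d.length := by rw [← vtx_fst, ← vtx_fst, hc, hd]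
  rw [← hc, ← hd, wordS_vtx, wordS_vtx]
  exact ⟨⟨_, word_mul_star_mem_coeffAlgebra hcd⟩, subset_cstarGen _ ⟨c, d, hcd, rfl⟩, rfl⟩

/-! ### Cuntz–Toeplitz isometries from a covariant pair -/

section Covariant

variable {D : Type u} [CStarAlgebra D] {π : coeffAlgebra s →⋆ₐ[ℂ] D} {V : D}

/-- Applying `π` to `shiftEndo_shiftTransfer` gives `V π(L b) V⋆ = VV⋆ π(b) VV⋆`, with `L` the
transfer map; compressing by `V` isolates `π(L b)`. -/
theorem IsCovariant.star_mul_mul (h : IsCovariant (shiftEndo s) π V) (b : coeffAlgebra s) :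
    star V * π b * V = π (shiftTransfer b) := by
  have h1 := congrArg π (shiftEndo_shiftTransfer b)
  rw [map_mul, map_mul, h.covariant, h.covariant 1, map_one, mul_one] at h1
  have h2 := congrArg (fun x => star V * x * V) h1
  have h3 : ∀ x : D, star V * (V * x * star V) * V = x := fun x => by
    calc star V * (V * x * star V) * V = (star V * V) * x * (star V * V) := by
          simp only [mul_assoc]
      _ = x := by rw [h.isometry, one_mul, mul_one]
  have h4 : ∀ x : D, star V * (V * star V * x * (V * star V)) * V = star V * x * V := fun x => by
    calc star V * (V * star V * x * (V * star V)) * V =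
          (star V * V) * star V * x * V * (star V * V) := by simp only [mul_assoc]
      _ = _ := by rw [h.isometry, one_mul, mul_one]
  simp only [h3, h4] at h2
  exact h2.symm

/-- The isometries `√s π(S_j S_0⋆) V` of a covariant pair `(π, V)`. -/
def covariantGen (π : coeffAlgebra s →⋆ₐ[ℂ] D) (V : D) (j : Fin s) : D :=
  ((Real.sqrt s : ℝ) : ℂ) • (π (unitB j 0) * V)

/-- The product of two generators is `s V⋆ π(S_0 S_j⋆ S_k S_0⋆) V`, which the transfer formula
evaluates inside `B_S`. -/
theorem IsCovariant.orthIsometries (h : IsCovariant (shiftEndo s) π V) :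
    OrthIsometries (covariantGen π V) := by
  intro j k
  have h1 : star (π (unitB j 0) * V) * (π (unitB k 0) * V) =
      star V * π (unitB 0 j * unitB k 0) * V := by
    rw [star_mul, ← map_star, star_unitB, map_mul]
    simp only [mul_assoc]
  rw [covariantGen, covariantGen, star_smul, smul_mul_smul_comm, h1, h.star_mul_mul,
    shiftTransfer_unitB, RCLike.star_def, Complex.conj_ofReal]
  split_ifs
  · rw [← Complex.ofReal_mul, Real.mul_self_sqrt (Nat.cast_nonneg s), Complex.ofReal_natCast,
      ← map_smul, smul_inv_sqrt_smul, map_one]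
  · simp

/-- `V = π(α(1)) V` for `α = shiftEndo s`, and `α(1) = SS⋆` absorbs `∑ S_j S_0⋆` from the left. -/
theorem IsCovariant.sum_covariantGen (h : IsCovariant (shiftEndo s) π V) :
    ((1 / Real.sqrt s : ℝ) : ℂ) • ∑ j, covariantGen π V j = V := by
  have hV : π (shiftEndo s 1) * V = V := by
    rw [h.covariant, map_one, mul_one, mul_assoc, h.isometry, mul_one]
  simp only [covariantGen, ← Finset.smul_sum, ← Finset.sum_mul, ← map_sum]
  rw [smul_smul, mul_comm, sqrt_mul_inv_sqrt, one_smul]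
  conv_lhs => rw [← hV, ← mul_assoc, ← map_mul, sum_unitB_mul_shiftEndo_one, hV]

theorem IsCovariant.covariantGen_mul (h : IsCovariant (shiftEndo s) π V) (j k : Fin s)
    (y : coeffAlgebra s) : covariantGen π V j * π y * star (covariantGen π V k) =
      π ((s : ℂ) • (unitB j 0 * shiftEndo s y * unitB 0 k)) := by
  rw [map_smul, map_mul, map_mul, h.covariant, covariantGen, covariantGen, star_smul, star_mul,
    ← map_star, star_unitB, smul_mul_assoc, smul_mul_smul_comm, RCLike.star_def,
    Complex.conj_ofReal, ← Complex.ofReal_mul, Real.mul_self_sqrt (Nat.cast_nonneg s),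
    Complex.ofReal_natCast]
  simp only [mul_assoc]

theorem IsCovariant.exists_extension (h : IsCovariant (shiftEndo s) π V) :
    ∃ φ : shiftAlgebra s →⋆ₐ[ℂ] D,
      (∀ b, φ (StarSubalgebra.inclusion (coeffAlgebra_le s) b) = π b) ∧
        φ ⟨shift s, shift_mem s⟩ = V := by
  obtain ⟨φ, hφ⟩ := exists_starAlgHom h.orthIsometries
  refine ⟨φ, fun b => ?_, ?_⟩
  · suffices hw : ∀ (c d : List (Fin s)) (b : coeffAlgebra s), c.length = d.length →
        (b : Op s) = word (genS s) c * star (word (genS s) d) →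
          φ (StarSubalgebra.inclusion (coeffAlgebra_le s) b) = π b by
      have : φ.comp (StarSubalgebra.inclusion (coeffAlgebra_le s)) = π :=
        starAlgHom_ext cstarGen_coeffAlgebra_eq_top fun b ⟨c, d, hcd, hb⟩ => hw c d b hcd hb
      exact DFunLike.congr_fun this b
    intro c
    induction c with
    | nil =>
      intro d b hcd hb
      obtain rfl : d = [] := List.length_eq_zero_iff.1 hcd.symm
      obtain rfl : b = 1 := Subtype.ext (by simpa using hb)
      rw [map_one, map_one, map_one]
    | cons j c ih =>
      intro d b hcd hb
      cases d with
      | nil => simp at hcd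
      | cons k d =>
        have hcd' : c.length = d.length := by simpa using hcd
        let y : coeffAlgebra s := ⟨_, word_mul_star_mem_coeffAlgebra hcd'⟩
        -- Peeling off the outer letters: `φ` sees `S_j y S_k⋆` as a product of generators, `π` sees
        -- it through `shiftEndo s y`, and `covariantGen_mul` matches the two.
        have hb' : b = (s : ℂ) • (unitB j 0 * shiftEndo s y * unitB 0 k) := by
          refine Subtype.ext ?_
          rw [smul_unitB_mul_shiftEndo_mul_unitB, hb]
          simp [y, mul_assoc]
        have hb2 : StarSubalgebra.inclusion (coeffAlgebra_le s) b =
            (⟨genS s j, genS_mem s j⟩ : shiftAlgebra s) *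
              StarSubalgebra.inclusion (coeffAlgebra_le s) y *
                star (⟨genS s k, genS_mem s k⟩ : shiftAlgebra s) := by
          refine Subtype.ext ?_
          rw [MulMemClass.coe_mul, MulMemClass.coe_mul, StarMemClass.coe_star, coe_inclusion,
            coe_inclusion, hb]
          simp [y, mul_assoc]
        rw [hb2, map_mul, map_mul, map_star, hφ, hφ, ih d y hcd' rfl, h.covariantGen_mul, hb']
  · have hS : (⟨shift s, shift_mem s⟩ : shiftAlgebra s) =
        ((1 / Real.sqrt s : ℝ) : ℂ) • ∑ j, ⟨genS s j, genS_mem s j⟩ := by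
      refine Subtype.ext ?_
      rw [SetLike.val_smul, AddSubmonoidClass.coe_finsetSum]
      exact shift_eq_sum
    rw [hS, map_smul, map_sum]
    simp only [hφ]
    exact h.sum_covariantGen

end Covariant

theorem isCrossedProduct_shiftAlgebra : IsCrossedProduct.{0, 0, u} (shiftEndo s)
    (StarSubalgebra.inclusion (coeffAlgebra_le s))
    (⟨shift s, shift_mem s⟩ : shiftAlgebra s) where
  isCovariant := isCovariant_shift
  generates := generates_crossedProduct
  universal D _ π V h := by
    obtain ⟨φ, hφ, hφV⟩ := h.exists_extension
    refine ⟨φ, ⟨hφ, hφV⟩, fun ψ ⟨hψ, hψV⟩ => starAlgHom_ext generates_crossedProduct ?_⟩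
    rintro _ (⟨b, rfl⟩ | rfl)
    · exact (hψ b).trans (hφ b).symm
    · exact hψV.trans hφV.symm

end Shift

end BernoulliShift

end

theorem mainTheorem4 (s : ℕ) [NeZero s] (hs : 2 ≤ s) :
    BernoulliShift.shiftAlgebra s = BernoulliShift.cstarGen (Set.range (BernoulliShift.genS s)) ∧
    BernoulliShift.IsCuntzToeplitz.{0, u} s
      (fun j => (⟨BernoulliShift.genS s j, BernoulliShift.genS_mem s j⟩ :
        BernoulliShift.shiftAlgebra s)) ∧
    (BernoulliShift.coeffAlgebra s : Set (BernoulliShift.Op s)) =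
      {a | a ∈ BernoulliShift.shiftAlgebra s ∧ ∀ θ : ℝ, BernoulliShift.gauge s θ a = a} ∧
    ∃ α : BernoulliShift.coeffAlgebra s →⋆ₙₐ[ℂ] BernoulliShift.coeffAlgebra s,
      (∀ b, (α b : BernoulliShift.Op s) =
        BernoulliShift.shift s * b * star (BernoulliShift.shift s)) ∧
      Function.Injective α ∧
      Set.range α = {x | ∃ b, x = α 1 * b * α 1} ∧
      BernoulliShift.IsCrossedProduct.{0, 0, u} α
        (StarSubalgebra.inclusion (BernoulliShift.coeffAlgebra_le s))
        (⟨BernoulliShift.shift s, BernoulliShift.shift_mem s⟩ :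
          BernoulliShift.shiftAlgebra s) :=
  ⟨BernoulliShift.shiftAlgebra_eq, BernoulliShift.isCuntzToeplitz_shiftAlgebra,
    BernoulliShift.coeffAlgebra_eq, BernoulliShift.shiftEndo s, BernoulliShift.shiftEndo_coe,
    BernoulliShift.shiftEndo_injective, BernoulliShift.range_shiftEndo,
    BernoulliShift.isCrossedProduct_shiftAlgebra⟩
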